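/- **Conventions.** Let $\Phi$ be a real $m\times N$ matrix, $m\le N$, with columns $\phi_1,\dots,\phi_N$ of unit Euclidean norm. Put $\mu_{i,j}=|\langle\phi_i,\phi_j\rangle|$, $\mu=\max_{i\ne j}\mu_{i,j}$ and $\bar\mu^2=\max_{1\le j\le N}\frac1{N-1}\sum_{i\ne j}\mu_{i,j}^2$, and let $\|\Phi\|$ be the spectral norm. A random vector $x\in\mathbb R^N$ is drawn from the generic random signal model $\mathcal S_k$ if (1) the set $I$ of locations of its $k$ coordinates of largest magnitude is uniformly distributed on the $k$-subsets of $\{1,\dots,N\}$, and (2) conditionally on $I$, the signs of the coordinates $x_i$, $i\in I$, are independent and uniform on $\{1,-1\}$; nothing is assumed about the magnitudes. Basis Pursuit recovers $x$ if $x$ is the unique minimizer of $\|z\|_1$ over all $z\in\mathbb R^N$ with $\Phi z=\Phi x$. **Proposition.** Suppose that $$\mu=O(m^{-1/4}),\qquad \bar\mu^2=O(1/m),\qquad \|\Phi\|=O\big(\sqrt{N/k}\big),\qquad m=\Theta\big(k\,(\log (N/\epsilon))^3\big),$$ and $k<1/\epsilon$, where $k\ge1$ and $\epsilon>0$. Then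 for all sufficiently large $N$, if $x$ is drawn from $\mathcal S_k$ and is almost surely $k$-sparse (at most $k$ nonzero coordinates), Basis Pursuit recovers $x$ except on an event of probability at most $\epsilon$. Precisely: for all real constants $C_1,C_2,C_3,C$ and $c>0$ there is $N_0$ such that for all $N\ge N_0$, all $m\le N$, $k\ge1$, $\epsilon>0$ with $k<1/\epsilon$ and $c\,k(\log(N/\epsilon))^3\le m\le C\,k(\log(N/\epsilon))^3$, and every $\Phi$ as above with $\mu\le C_1m^{-1/4}$, $\bar\mu^2\le C_2/m$ and $\|\Phi\|\le C_3\sqrt{N/k}$, every $k$-sparse random signal $x$ from $\mathcal S_k$ is recovered by Basis Pursuit with probability at least $1-\epsilon$. -/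

import Mathlib

open MeasureTheory ProbabilityTheory

namespace SparseRecovery

noncomputable section

/-- All columns `φ_j` of `Φ` have unit Euclidean norm. -/
def UnitNormColumns {m N : ℕ} (Φ : Matrix (Fin m) (Fin N) ℝ) : Prop :=
  ∀ j, ‖WithLp.toLp 2 (Φ.col j)‖ = 1

/-- The coherence `μ_{i,j} = |⟨φ_i, φ_j⟩|` of two columns. -/
def pairCoherence {m N : ℕ} (Φ : Matrix (Fin m) (Fin N) ℝ) (i j : Fin N) : ℝ :=
  |Φ.col i ⬝ᵥ Φ.col j|

/-- The mutual coherence `μ = max_{i ≠ j} μ_{i,j}`. -/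
def mutualCoherence {m N : ℕ} (Φ : Matrix (Fin m) (Fin N) ℝ) : ℝ :=
  ⨆ p : {p : Fin N × Fin N // p.1 ≠ p.2}, pairCoherence Φ p.1.1 p.1.2

/-- The mean square coherence `max_j (N - 1)⁻¹ ∑_{i ≠ j} μ_{i,j}²`. -/
def meanSquareCoherence {m N : ℕ} (Φ : Matrix (Fin m) (Fin N) ℝ) : ℝ :=
  ⨆ j : Fin N, 1 / ((N : ℝ) - 1) * ∑ i ∈ Finset.univ.erase j, pairCoherence Φ i j ^ 2

/-- The spectral norm `‖Φ‖`: the operator norm between Euclidean spaces. -/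
def specNorm {m N : ℕ} (Φ : Matrix (Fin m) (Fin N) ℝ) : ℝ :=
  ‖(Matrix.toEuclideanLin Φ).toContinuousLinearMap‖

/-- The `ℓ₁` norm on `ℝ^N`. -/
def l1norm {N : ℕ} (z : Fin N → ℝ) : ℝ := ∑ i, |z i|

/-- The set of outputs of Basis Pursuit on the sketch `y`: all minimizers of `‖z‖₁` subject to
`Φ z = y`. -/
def basisPursuit {m N : ℕ} (Φ : Matrix (Fin m) (Fin N) ℝ) (y : Fin m → ℝ) : Set (Fin N → ℝ) :=
  {z | Φ.mulVec z = y ∧ ∀ w, Φ.mulVec w = y → l1norm z ≤ l1norm w}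

/-- Basis Pursuit recovers `x` from its sketch `Φ x`: the minimizer is unique and equal to `x`. -/
def BPRecovers {m N : ℕ} (Φ : Matrix (Fin m) (Fin N) ℝ) (x : Fin N → ℝ) : Prop :=
  basisPursuit Φ (Φ.mulVec x) = {x}

/-- `x` has at most `k` nonzero coordinates. -/
def IsSparse {N : ℕ} (k : ℕ) (x : Fin N → ℝ) : Prop :=
  (Finset.univ.filter fun i => x i ≠ 0).card ≤ k

/-- The random vector `x` is drawn from the generic random signal model `S_k`. The random set `I` is
the set of locations of the `k` coordinates of largest magnitude (chosen in some way when there are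
ties). It is uniform on the `k`-subsets, and conditionally on `I = J` the signs of `x_i`, `i ∈ J`,
are independent and uniform on `{1, -1}`. Nothing is assumed about the magnitudes. -/
def IsGenericRandomSignal {Ω : Type*} [MeasurableSpace Ω] (P : Measure Ω) {N : ℕ} (k : ℕ)
    (x : Ω → Fin N → ℝ) : Prop :=
  Measurable x ∧
  ∃ I : Ω → Finset (Fin N),
    (∀ J, MeasurableSet {ω | I ω = J}) ∧
    (∀ᵐ ω ∂P, (I ω).card = k ∧ ∀ i ∈ I ω, ∀ j ∉ I ω, |x ω j| ≤ |x ω i|) ∧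
    ∀ J : Finset (Fin N), J.card = k →
      P {ω | I ω = J} = (N.choose k : ENNReal)⁻¹ ∧
      iIndepFun (fun (i : J) (ω : Ω) => Real.sign (x ω i)) (cond P {ω | I ω = J}) ∧
      ∀ i ∈ J, cond P {ω | I ω = J} {ω | Real.sign (x ω i) = 1} = 2⁻¹ ∧
        cond P {ω | I ω = J} {ω | Real.sign (x ω i) = -1} = 2⁻¹

end

end SparseRecovery

/-!
Conditionally on the support `J`, the least-squares dual certificate built from the random signs
has, at every column off `J`, a Rademacher sum whose variance is at most a multiple of
`∑ i ∈ J, ⟨φ_i, φ_j⟩²`, as soon as the columns indexed by `J` are uniformly linearly independent.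
By Hoeffding's inequality it is then smaller than one at all columns off `J`, which certifies
recovery. So it remains to show that a random `k`-subset of the columns is well conditioned and has
short rows in the Gram matrix.

Only a lower bound for the Gram matrix on `J` is required, so its spectrum may be cut at a height
proportional to `N / k`; this costs little on the diagonal, and makes any bound on `‖Φ‖`
superfluous. Splitting `J` at random into two parts decouples the quadratic form of the truncated
Gram matrix without its diagonal, and reduces it to `∑ i ∈ I, x_i x_iᵀ` for random sets `I` of
short vectors. The trace moments of such a sum are bounded by taking the vectors away one at a
time: tested at `x_i` itself, the rank-one term `x_i x_iᵀ` does no more than a multiple of the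
identity.
-/

namespace SparseRecovery

open Matrix
open scoped BigOperators MatrixOrder

section SpectralCalculus

variable {n : Type*} [Fintype n] [DecidableEq n] {A : Matrix n n ℝ}

theorem dotProduct_cfc_mulVec (hA : A.IsHermitian) (f : ℝ → ℝ) (x : n → ℝ) :
    x ⬝ᵥ cfc f A *ᵥ x =
      ∑ i, f (hA.eigenvalues i) * ((hA.eigenvectorUnitary : Matrix n n ℝ)ᵀ *ᵥ x) i ^ 2 := by
  rw [hA.cfc_eq, IsHermitian.cfc, Unitary.conjStarAlgAut_apply, star_eq_conjTranspose,
    conjTranspose_eq_transpose_of_trivial, ← mulVec_mulVec, ← mulVec_mulVec, dotProduct_mulVec,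
    ← mulVec_transpose]
  simp only [dotProduct, mulVec_diagonal]
  exact Finset.sum_congr rfl fun i _ => by
    simp only [Function.comp_apply, RCLike.ofReal_real_eq_id, id]
    ring

theorem dotProduct_self_eq_sum_eigenvectorUnitary (hA : A.IsHermitian) (x : n → ℝ) :
    x ⬝ᵥ x = ∑ i, ((hA.eigenvectorUnitary : Matrix n n ℝ)ᵀ *ᵥ x) i ^ 2 := by
  simpa [cfc_const_one ℝ A hA.isSelfAdjoint] using dotProduct_cfc_mulVec hA (fun _ => 1) x

theorem trace_cfc (hA : A.IsHermitian) (f : ℝ → ℝ) :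
    (cfc f A).trace = ∑ i, f (hA.eigenvalues i) := by
  rw [hA.cfc_eq, IsHermitian.cfc, Unitary.conjStarAlgAut_apply, Matrix.trace_mul_cycle,
    Unitary.coe_star_mul_self, Matrix.one_mul, trace_diagonal]
  rfl

theorem trace_pow_eq_sum_eigenvalues_pow (hA : A.IsHermitian) (p : ℕ) :
    (A ^ p).trace = ∑ i, hA.eigenvalues i ^ p := by
  rw [← trace_cfc hA (· ^ p), cfc_pow_id (R := ℝ) A p hA.isSelfAdjoint]

theorem sum_mul_mul_sum_mul_le_of_monovary {ι : Type*} [Fintype ι] {w f g : ι → ℝ}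
    (hw : 0 ≤ w) (hfg : Monovary f g) :
    (∑ i, f i * w i) * ∑ i, g i * w i ≤ (∑ i, w i) * ∑ i, f i * g i * w i := by
  have h0 : 0 ≤ ∑ i, ∑ j, w i * w j * ((f j - f i) * (g j - g i)) :=
    Finset.sum_nonneg fun i _ => Finset.sum_nonneg fun j _ =>
      mul_nonneg (mul_nonneg (hw i) (hw j)) (monovary_iff_forall_mul_nonneg.1 hfg i j)
  have expand : ∑ i, ∑ j, w i * w j * ((f j - f i) * (g j - g i)) =
      2 * ((∑ i, w i) * ∑ i, f i * g i * w i) - 2 * ((∑ i, f i * w i) * ∑ i, g i * w i) := by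
    calc ∑ i, ∑ j, w i * w j * ((f j - f i) * (g j - g i))
        = ∑ i, ∑ j, (w i * (f j * g j * w j) + f i * g i * w i * w j
            - f i * w i * (g j * w j) - g i * w i * (f j * w j)) :=
          Finset.sum_congr rfl fun i _ => Finset.sum_congr rfl fun j _ => by ring
      _ = _ := by
          simp only [Finset.sum_add_distrib, Finset.sum_sub_distrib, ← Finset.mul_sum,
            ← Finset.sum_mul]
          ring
  linarith

/-- Chebyshev's association inequality for the spectral measure of `A` at `x`. -/
theorem dotProduct_cfc_mul_dotProduct_cfc_le {f g : ℝ → ℝ} (hA : A.IsHermitian)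
    (hfg : MonovaryOn f g (spectrum ℝ A)) (x : n → ℝ) :
    (x ⬝ᵥ cfc f A *ᵥ x) * (x ⬝ᵥ cfc g A *ᵥ x) ≤ (x ⬝ᵥ x) * (x ⬝ᵥ (cfc f A * cfc g A) *ᵥ x) := by
  have hcont (f : ℝ → ℝ) : ContinuousOn f (spectrum ℝ A) := A.finite_real_spectrum.continuousOn f
  rw [← cfc_mul f g A (hcont f) (hcont g), dotProduct_cfc_mulVec hA, dotProduct_cfc_mulVec hA,
    dotProduct_cfc_mulVec hA, dotProduct_self_eq_sum_eigenvectorUnitary hA]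
  exact sum_mul_mul_sum_mul_le_of_monovary (fun i => sq_nonneg _) fun i j hij =>
    hfg (hA.eigenvalues_mem_spectrum_real i) (hA.eigenvalues_mem_spectrum_real j) hij

theorem cfc_add_const_pow (hA : A.IsHermitian) (r : ℝ) (q : ℕ) :
    cfc (fun t => (t + r) ^ q) A = (A + r • 1) ^ q := by
  rw [cfc_pow (fun t : ℝ => t + r) q A (by fun_prop) hA.isSelfAdjoint,
    cfc_add_const r (fun t => t) A (by fun_prop) hA.isSelfAdjoint, cfc_id' ℝ A hA.isSelfAdjoint,
    Algebra.algebraMap_eq_smul_one]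

theorem dotProduct_pow_mul_pow_le (hA : A.PosSemidef) {r : ℝ} (hr : 0 ≤ r) (a q : ℕ)
    (x : n → ℝ) :
    (x ⬝ᵥ (A ^ a) *ᵥ x) * (x ⬝ᵥ ((A + r • 1) ^ q) *ᵥ x) ≤
      (x ⬝ᵥ x) * (x ⬝ᵥ (A ^ a * (A + r • 1) ^ q) *ᵥ x) := by
  have hspec : ∀ t ∈ spectrum ℝ A, 0 ≤ t := fun t ht =>
    spectrum_nonneg_of_nonneg (nonneg_iff_posSemidef.2 hA) ht
  rw [← cfc_add_const_pow hA.1, ← cfc_pow_id (R := ℝ) A a hA.1.isSelfAdjoint]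
  refine dotProduct_cfc_mul_dotProduct_cfc_le hA.1 (MonotoneOn.monovaryOn (fun s hs t _ hst => ?_)
    fun s hs t _ hst => ?_) x
  · exact pow_le_pow_left₀ (hspec s hs) hst a
  · exact pow_le_pow_left₀ (add_nonneg (hspec s hs) hr) (by linarith) q

theorem dotProduct_pow_mul_add_pow_nonneg (hA : A.PosSemidef) {r : ℝ} (hr : 0 ≤ r) (a q : ℕ)
    (x : n → ℝ) : 0 ≤ x ⬝ᵥ (A ^ a * (A + r • 1) ^ q) *ᵥ x := by
  rw [← cfc_add_const_pow hA.1, ← cfc_pow_id (R := ℝ) A a hA.1.isSelfAdjoint,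
    ← cfc_mul _ _ A (by fun_prop) (by fun_prop), dotProduct_cfc_mulVec hA.1]
  exact Finset.sum_nonneg fun i _ => mul_nonneg (mul_nonneg (pow_nonneg (hA.eigenvalues_nonneg i) _)
    (pow_nonneg (add_nonneg (hA.eigenvalues_nonneg i) hr) _)) (sq_nonneg _)

theorem dotProduct_pow_mul_add_vecMulVec_pow_le (hA : A.PosSemidef) {r : ℝ} {x : n → ℝ}
    (hr : x ⬝ᵥ x ≤ r) (a q : ℕ) :
    x ⬝ᵥ (A ^ a * (A + vecMulVec x x) ^ q) *ᵥ x ≤ x ⬝ᵥ (A ^ a * (A + r • 1) ^ q) *ᵥ x := by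
  have hr0 : 0 ≤ r := (by simpa using dotProduct_star_self_nonneg x : 0 ≤ x ⬝ᵥ x).trans hr
  have split (B : Matrix n n ℝ) (a q : ℕ) : A ^ a * (A + B) ^ (q + 1) =
      A ^ (a + 1) * (A + B) ^ q + A ^ a * (B * (A + B) ^ q) := by
    rw [pow_succ' (A + B), add_mul, mul_add, pow_succ, mul_assoc]
  induction q generalizing a with
  | zero => simp
  | succ q ih =>
    rw [split, split, add_mulVec, add_mulVec, dotProduct_add, dotProduct_add]
    refine add_le_add (ih (a + 1)) ?_
    have ih₀ := ih 0
    rw [pow_zero, one_mul, one_mul] at ih₀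
    calc x ⬝ᵥ (A ^ a * (vecMulVec x x * (A + vecMulVec x x) ^ q)) *ᵥ x
        = (x ⬝ᵥ (A ^ a) *ᵥ x) * (x ⬝ᵥ ((A + vecMulVec x x) ^ q) *ᵥ x) := by
          simp [← mulVec_mulVec, vecMulVec_mulVec, mulVec_smul, mul_comm]
      _ ≤ (x ⬝ᵥ (A ^ a) *ᵥ x) * (x ⬝ᵥ ((A + r • 1) ^ q) *ᵥ x) :=
          mul_le_mul_of_nonneg_left ih₀ (by simpa using (hA.pow a).dotProduct_mulVec_nonneg x)
      _ ≤ (x ⬝ᵥ x) * (x ⬝ᵥ (A ^ a * (A + r • 1) ^ q) *ᵥ x) := dotProduct_pow_mul_pow_le hA hr0 a q x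
      _ ≤ r * (x ⬝ᵥ (A ^ a * (A + r • 1) ^ q) *ᵥ x) :=
          mul_le_mul_of_nonneg_right hr (dotProduct_pow_mul_add_pow_nonneg hA hr0 a q x)
      _ = x ⬝ᵥ (A ^ a * (r • 1 * (A + r • 1) ^ q)) *ᵥ x := by simp [smul_mulVec]

theorem exists_le_eigenvalues (hA : A.IsHermitian) {t : ℝ} {z : n → ℝ} (hz0 : z ≠ 0)
    (hz : t * (z ⬝ᵥ z) ≤ z ⬝ᵥ A *ᵥ z) : ∃ i, t ≤ hA.eigenvalues i := by
  by_contra! h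
  have hquad := dotProduct_cfc_mulVec hA id z
  rw [cfc_id ℝ A hA.isSelfAdjoint] at hquad
  rw [hquad, dotProduct_self_eq_sum_eigenvectorUnitary hA, Finset.mul_sum] at hz
  have hzz : z ⬝ᵥ z ≠ 0 := fun h => hz0 (dotProduct_self_eq_zero.1 h)
  rw [dotProduct_self_eq_sum_eigenvectorUnitary hA] at hzz
  obtain ⟨i, hi, hne⟩ := Finset.exists_ne_zero_of_sum_ne_zero hzz
  exact absurd hz (not_le.2 (Finset.sum_lt_sum
    (fun j _ => mul_le_mul_of_nonneg_right (h j).le (sq_nonneg _))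
    ⟨i, hi, mul_lt_mul_of_pos_right (h i) ((sq_nonneg _).lt_of_ne' hne)⟩))

theorem pow_le_trace_pow (hA : A.PosSemidef) {t : ℝ} (ht : 0 ≤ t) {z : n → ℝ}
    (hz0 : z ≠ 0) (hz : t * (z ⬝ᵥ z) ≤ z ⬝ᵥ A *ᵥ z) (p : ℕ) : t ^ p ≤ (A ^ p).trace := by
  obtain ⟨i, hi⟩ := exists_le_eigenvalues hA.1 hz0 hz
  rw [trace_pow_eq_sum_eigenvalues_pow hA.1]
  exact (pow_le_pow_left₀ ht hi p).trans (Finset.single_le_sum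
    (f := fun i => hA.1.eigenvalues i ^ p)
    (fun j _ => pow_nonneg (hA.eigenvalues_nonneg j) p) (Finset.mem_univ i))

omit [Fintype n] [DecidableEq n] in
theorem abs_apply_le_of_posSemidef (hA : A.PosSemidef) {d : ℝ} (hd : ∀ i, A i i ≤ d) (i j : n) :
    |A i j| ≤ d := by
  have hsymm : A j i = A i j := by simpa using hA.1.apply i j
  have quad (c : ℝ) : 0 ≤ A i i + 2 * c * A i j + c ^ 2 * A j j := by
    have h := (hA.submatrix ![i, j]).dotProduct_mulVec_nonneg ![1, c]
    simp [dotProduct, mulVec, Fin.sum_univ_two, hsymm] at h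
    linarith
  have h₁ := quad 1
  have h₂ := quad (-1)
  exact abs_le.2 ⟨by linarith [hd i, hd j], by linarith [hd i, hd j]⟩

/-- The matrix `A` with its spectrum cut at height `κ`. -/
noncomputable def spectralTruncation (A : Matrix n n ℝ) (κ : ℝ) : Matrix n n ℝ :=
  cfc (min · κ) A

variable {κ : ℝ}

theorem spectralTruncation_posSemidef (hA : A.PosSemidef) (hκ : 0 ≤ κ) :
    (spectralTruncation A κ).PosSemidef :=
  nonneg_iff_posSemidef.1 <| cfc_nonneg fun _ ht =>
    le_min (spectrum_nonneg_of_nonneg (nonneg_iff_posSemidef.2 hA) ht) hκ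

theorem spectralTruncation_le (hA : A.IsHermitian) : spectralTruncation A κ ≤ A :=
  (cfc_mono (fun _ _ => min_le_left _ _)).trans_eq (cfc_id ℝ A hA.isSelfAdjoint)

theorem spectralTruncation_sq (hA : A.IsHermitian) :
    spectralTruncation A κ ^ 2 = cfc (fun t => min t κ ^ 2) A :=
  (cfc_pow _ 2 A (by fun_prop) hA.isSelfAdjoint).symm

theorem sub_spectralTruncation_le (hA : A.PosSemidef) (hκ : 0 < κ) :
    A - spectralTruncation A κ ≤ κ⁻¹ • A ^ 2 := by
  calc A - spectralTruncation A κ = cfc (fun t => t - min t κ) A := by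
        rw [cfc_sub _ _ A, cfc_id' ℝ A hA.1.isSelfAdjoint, spectralTruncation]
    _ ≤ cfc (fun t => κ⁻¹ • t ^ 2) A := cfc_mono fun t ht => by
        have ht0 := spectrum_nonneg_of_nonneg (nonneg_iff_posSemidef.2 hA) ht
        rw [smul_eq_mul, inv_mul_eq_div, le_div_iff₀ hκ]
        rcases le_total t κ with h | h
        · rw [min_eq_left h]
          nlinarith
        · rw [min_eq_right h]
          nlinarith
    _ = κ⁻¹ • A ^ 2 := by rw [cfc_smul _ _ A, cfc_pow_id (R := ℝ) A 2 hA.1.isSelfAdjoint]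

theorem spectralTruncation_sq_le (hA : A.PosSemidef) (hκ : 0 ≤ κ) :
    spectralTruncation A κ ^ 2 ≤ A ^ 2 := by
  rw [spectralTruncation_sq hA.1, ← cfc_pow_id (R := ℝ) A 2 hA.1.isSelfAdjoint]
  exact cfc_mono fun t ht => pow_le_pow_left₀
    (le_min (spectrum_nonneg_of_nonneg (nonneg_iff_posSemidef.2 hA) ht) hκ) (min_le_left _ _) 2

theorem dotProduct_spectralTruncation_sq_le (hA : A.PosSemidef) (hκ : 0 ≤ κ) (z : n → ℝ) :
    z ⬝ᵥ (spectralTruncation A κ ^ 2) *ᵥ z ≤ κ ^ 2 * (z ⬝ᵥ z) := by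
  rw [spectralTruncation_sq hA.1, dotProduct_cfc_mulVec hA.1,
    dotProduct_self_eq_sum_eigenvectorUnitary hA.1, Finset.mul_sum]
  exact Finset.sum_le_sum fun i _ => mul_le_mul_of_nonneg_right
    (pow_le_pow_left₀ (le_min (hA.eigenvalues_nonneg i) hκ) (min_le_right _ _) 2) (sq_nonneg _)

end SpectralCalculus

section RandomSubsets

open Finset

variable {ι : Type*}

open Classical in
/-- The probability that a uniformly random `k`-element subset of `ι` has the property `p`. -/
noncomputable def subsetProb [Fintype ι] (k : ℕ) (p : Finset ι → Prop) : ℝ :=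
  𝔼 I ∈ (univ : Finset ι).powersetCard k, if p I then 1 else 0

section SubsetProb

variable [Fintype ι] {k : ℕ} {p q : Finset ι → Prop}

theorem subsetProb_mono (h : ∀ I : Finset ι, #I = k → p I → q I) :
    subsetProb k p ≤ subsetProb k q := by
  refine expect_le_expect fun I hI => ?_
  have := h I (mem_powersetCard.1 hI).2
  split_ifs <;> simp_all

theorem subsetProb_or_le : subsetProb k (fun I => p I ∨ q I) ≤ subsetProb k p + subsetProb k q := by
  rw [subsetProb, subsetProb, subsetProb, ← expect_add_distrib]
  refine expect_le_expect fun I _ => ?_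
  by_cases hp : p I <;> by_cases hq : q I <;> simp [hp, hq]

theorem subsetProb_exists_le {κ : Type*} [Fintype κ] {p : κ → Finset ι → Prop} {δ : ℝ}
    (h : ∀ j, subsetProb k (p j) ≤ δ) :
    subsetProb k (fun I => ∃ j, p j I) ≤ Fintype.card κ * δ := by
  classical
  calc subsetProb k (fun I => ∃ j, p j I) ≤ ∑ j, subsetProb k (p j) := by
        simp only [subsetProb]
        rw [← expect_sum_comm]
        refine expect_le_expect fun I _ => ?_
        split_ifs with hI
        · obtain ⟨j, hj⟩ := hI
          exact le_of_eq_of_le (if_pos hj).symm (single_le_sum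
            (f := fun j => if p j I then (1 : ℝ) else 0)
            (fun _ _ => by split_ifs <;> norm_num) (mem_univ j))
        · exact sum_nonneg fun _ _ => by split_ifs <;> norm_num
    _ ≤ Fintype.card κ * δ := by
        simpa using sum_le_sum fun j (_ : j ∈ univ) => h j

theorem subsetProb_mul_le_expect {g : Finset ι → ℝ} {t : ℝ} (hg : ∀ I, 0 ≤ g I)
    (h : ∀ I, p I → t ≤ g I) : subsetProb k p * t ≤ 𝔼 I ∈ univ.powersetCard k, g I := by
  rw [subsetProb, expect_mul]
  refine expect_le_expect fun I _ => ?_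
  split_ifs with hI
  · simpa using h I hI
  · simpa using hg I

end SubsetProb

variable [DecidableEq ι]

theorem sum_powersetCard_succ_erase {M : Type*} [AddCommMonoid M] (U : Finset ι) (k : ℕ)
    (f : ι → Finset ι → M) :
    ∑ I ∈ U.powersetCard (k + 1), ∑ i ∈ I, f i (I.erase i) =
      ∑ J ∈ U.powersetCard k, ∑ i ∈ U \ J, f i J := by
  rw [sum_sigma', sum_sigma']
  refine sum_bij' (fun q _ => ⟨q.1.erase q.2, q.2⟩) (fun q _ => ⟨insert q.2 q.1, q.2⟩)
    ?_ ?_ ?_ ?_ fun _ _ => rfl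
  · rintro ⟨I, i⟩ h
    simp only [mem_sigma, mem_powersetCard, mem_sdiff] at h ⊢
    obtain ⟨⟨hIU, hcard⟩, hi⟩ := h
    exact ⟨⟨(erase_subset _ _).trans hIU, by rw [card_erase_of_mem hi, hcard]; rfl⟩, hIU hi,
      notMem_erase _ _⟩
  · rintro ⟨J, i⟩ h
    simp only [mem_sigma, mem_powersetCard, mem_sdiff] at h ⊢
    obtain ⟨⟨hJU, hcard⟩, hiU, hiJ⟩ := h
    exact ⟨⟨insert_subset hiU hJU, by rw [card_insert_of_notMem hiJ, hcard]⟩, mem_insert_self _ _⟩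
  · rintro ⟨I, i⟩ h
    simp [insert_erase (mem_sigma.1 h).2]
  · rintro ⟨J, i⟩ h
    simp [erase_insert (mem_sdiff.1 (mem_sigma.1 h).2).2]

theorem expect_powersetCard_succ_erase {U : Finset ι} {k : ℕ} (hk : k < #U)
    (f : ι → Finset ι → ℝ) :
    𝔼 I ∈ U.powersetCard (k + 1), ∑ i ∈ I, f i (I.erase i) =
      (k + 1) / (#U - k) * 𝔼 J ∈ U.powersetCard k, ∑ i ∈ U \ J, f i J := by
  have hchoose : ((#U).choose (k + 1) : ℝ) * (k + 1) = (#U).choose k * (#U - k) := by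
    rw [← Nat.cast_sub hk.le]
    exact_mod_cast Nat.choose_succ_right_eq (#U) k
  have hU : (0 : ℝ) < #U - k := sub_pos.2 (by exact_mod_cast hk)
  have h₁ : ((#U).choose (k + 1) : ℝ) ≠ 0 := by exact_mod_cast (Nat.choose_pos hk).ne'
  have h₂ : ((#U).choose k : ℝ) ≠ 0 := by exact_mod_cast (Nat.choose_pos hk.le).ne'
  rw [expect_eq_sum_div_card, expect_eq_sum_div_card, sum_powersetCard_succ_erase,
    card_powersetCard, card_powersetCard, div_mul_div_comm, div_eq_div_iff h₁ (by positivity),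
    mul_comm (#U - k : ℝ), ← hchoose]
  ring

end RandomSubsets

section SampleGram

open Finset

variable {n ι : Type*} [Fintype n]

/-- The Gram matrix `∑ i ∈ I, x i (x i)ᵀ` of the vectors `x i`, `i ∈ I`. -/
def sampleGram (x : ι → n → ℝ) (I : Finset ι) : Matrix n n ℝ :=
  ∑ i ∈ I, vecMulVec (x i) (x i)

omit [Fintype n] in
theorem sampleGram_posSemidef [Finite n] (x : ι → n → ℝ) (I : Finset ι) :
    (sampleGram x I).PosSemidef :=
  posSemidef_sum I fun i _ => by simpa using posSemidef_vecMulVec_self_star (x i)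

theorem dotProduct_sampleGram_mulVec (x : ι → n → ℝ) (I : Finset ι) (z : n → ℝ) :
    z ⬝ᵥ sampleGram x I *ᵥ z = ∑ i ∈ I, (x i ⬝ᵥ z) ^ 2 := by
  simp only [sampleGram, sum_mulVec, dotProduct_sum, vecMulVec_mulVec]
  exact sum_congr rfl fun i _ => by simp [dotProduct_comm z, sq]

theorem trace_mul_sampleGram (Q : Matrix n n ℝ) (x : ι → n → ℝ) (I : Finset ι) :
    (Q * sampleGram x I).trace = ∑ i ∈ I, x i ⬝ᵥ Q *ᵥ x i := by
  rw [sampleGram, mul_sum, trace_sum]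
  exact sum_congr rfl fun i _ => by rw [mul_vecMulVec, trace_vecMulVec, dotProduct_comm]

theorem sum_dotProduct_mulVec_le_mul_trace {x : ι → n → ℝ} {U : Finset ι} {b : ℝ}
    (hb : ∀ z, ∑ i ∈ U, (x i ⬝ᵥ z) ^ 2 ≤ b * (z ⬝ᵥ z)) {Q : Matrix n n ℝ} (hQ : Q.PosSemidef) :
    ∑ i ∈ U, x i ⬝ᵥ Q *ᵥ x i ≤ b * Q.trace := by
  classical
  obtain ⟨R, rfl⟩ := CStarAlgebra.nonneg_iff_eq_star_mul_self.1 hQ.nonneg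
  rw [star_eq_conjTranspose, conjTranspose_eq_transpose_of_trivial]
  calc ∑ i ∈ U, x i ⬝ᵥ (Rᵀ * R) *ᵥ x i = ∑ l, ∑ i ∈ U, (x i ⬝ᵥ R l) ^ 2 := by
        rw [sum_comm]
        refine sum_congr rfl fun i _ => ?_
        rw [← mulVec_mulVec, dotProduct_mulVec, vecMul_transpose]
        exact sum_congr rfl fun l _ => by rw [← sq, dotProduct_comm]; rfl
    _ ≤ ∑ l, b * (R l ⬝ᵥ R l) := sum_le_sum fun l _ => hb (R l)
    _ = b * (Rᵀ * R).trace := by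
        rw [trace_mul_comm, ← mul_sum]
        rfl

variable {x : ι → n → ℝ} {U : Finset ι} {b r m₀ T t : ℝ} {k P : ℕ}

theorem expect_sum_dotProduct_mulVec_erase_le [DecidableEq ι]
    (hb : ∀ z, ∑ i ∈ U, (x i ⬝ᵥ z) ^ 2 ≤ b * (z ⬝ᵥ z)) (hk : k < #U)
    (hbk : b * (k + 1) ≤ m₀ * (#U - k)) {Q : Finset ι → Matrix n n ℝ}
    (hQ : ∀ J, (Q J).PosSemidef) :
    𝔼 I ∈ U.powersetCard (k + 1), ∑ i ∈ I, x i ⬝ᵥ Q (I.erase i) *ᵥ x i ≤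
      m₀ * 𝔼 J ∈ U.powersetCard k, (Q J).trace := by
  have hkU : (0 : ℝ) < #U - k := sub_pos.2 (by exact_mod_cast hk)
  rw [expect_powersetCard_succ_erase hk fun i J => x i ⬝ᵥ Q J *ᵥ x i]
  calc _ ≤ (k + 1) / (#U - k : ℝ) * 𝔼 J ∈ U.powersetCard k, b * (Q J).trace := by
        gcongr with J
        exact (sum_le_sum_of_subset_of_nonneg sdiff_subset fun i _ _ => by
          simpa using (hQ J).dotProduct_mulVec_nonneg (x i)).trans
            (sum_dotProduct_mulVec_le_mul_trace hb (hQ J))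
    _ = (k + 1) / (#U - k : ℝ) * b * 𝔼 J ∈ U.powersetCard k, (Q J).trace := by
        rw [← mul_expect, mul_assoc]
    _ ≤ m₀ * 𝔼 J ∈ U.powersetCard k, (Q J).trace := by
        refine mul_le_mul_of_nonneg_right ?_ (expect_nonneg fun J _ => (hQ J).trace_nonneg)
        rw [div_mul_eq_mul_div, div_le_iff₀ hkU]
        linarith

variable [DecidableEq n]

theorem pow_le_trace_sampleGram_pow {I : Finset ι} {z : n → ℝ} (ht : 0 ≤ t)
    (hz : t * (z ⬝ᵥ z) < ∑ i ∈ I, (x i ⬝ᵥ z) ^ 2) (p : ℕ) : t ^ p ≤ (sampleGram x I ^ p).trace := by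
  refine pow_le_trace_pow (sampleGram_posSemidef x I) ht (z := z) ?_ ?_ p
  · rintro rfl
    simp at hz
  · rw [dotProduct_sampleGram_mulVec]
    exact hz.le

variable [DecidableEq ι]

theorem trace_sampleGram_add_pow_succ_le {I : Finset ι} (hr : ∀ i ∈ I, x i ⬝ᵥ x i ≤ r) {s : ℝ}
    (hs : 0 ≤ s) (p : ℕ) :
    ((sampleGram x I + s • 1) ^ (p + 1)).trace ≤ s * ((sampleGram x I + s • 1) ^ p).trace +
      ∑ i ∈ I, x i ⬝ᵥ ((sampleGram x (I.erase i) + (s + r) • 1) ^ p) *ᵥ x i := by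
  rw [pow_succ, mul_add, trace_add, mul_smul_comm, mul_one, trace_smul, smul_eq_mul,
    trace_mul_sampleGram, add_comm]
  gcongr with i hi
  have hsplit : sampleGram x I + s • 1 =
      sampleGram x (I.erase i) + s • 1 + vecMulVec (x i) (x i) := by
    rw [sampleGram, ← add_sum_erase I _ hi, sampleGram]
    abel
  have hpsd : (sampleGram x (I.erase i) + s • 1).PosSemidef :=
    (sampleGram_posSemidef _ _).add (PosSemidef.one.smul hs)
  simpa [hsplit, add_smul, add_assoc] using
    dotProduct_pow_mul_add_vecMulVec_pow_le hpsd (hr i hi) 0 p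

theorem mul_add_pow_le_of_mul_exp_le {u : ℝ} {p : ℕ} (hr : 0 ≤ r) (hm₀ : 0 ≤ m₀) (hT : 0 < T)
    (hTu : T ≤ u) (hmT : m₀ * Real.exp (P * r / T) ≤ T) (hp : p ≤ P) :
    m₀ * (u + r) ^ p ≤ T * u ^ p := by
  have hu : 0 < u := hT.trans_le hTu
  have hexp : u + r ≤ u * Real.exp (r / T) := by
    calc u + r = u * (r / u + 1) := by field_simp; ring
      _ ≤ u * (r / T + 1) := by gcongr
      _ ≤ u * Real.exp (r / T) := by gcongr; exact Real.add_one_le_exp _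
  calc m₀ * (u + r) ^ p ≤ m₀ * (u * Real.exp (r / T)) ^ p := by gcongr
    _ = m₀ * Real.exp (p * r / T) * u ^ p := by
        rw [mul_pow, ← Real.exp_nat_mul, mul_div_assoc]; ring
    _ ≤ m₀ * Real.exp (P * r / T) * u ^ p := by gcongr
    _ ≤ T * u ^ p := by gcongr

omit [DecidableEq ι] in
theorem expect_trace_sampleGram_add_pow_le (hr0 : 0 ≤ r) (hr : ∀ i ∈ U, x i ⬝ᵥ x i ≤ r)
    (hb0 : 0 ≤ b) (hb : ∀ z, ∑ i ∈ U, (x i ⬝ᵥ z) ^ 2 ≤ b * (z ⬝ᵥ z)) (hm₀ : 0 ≤ m₀) (hT : 0 < T)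
    (hmT : m₀ * Real.exp (P * r / T) ≤ T) {p : ℕ} (hp : p ≤ P) {s : ℝ} (hs : 0 ≤ s)
    (hk : k ≤ #U) (hbk : b * k ≤ m₀ * (#U + 1 - k)) :
    𝔼 I ∈ U.powersetCard k, ((sampleGram x I + s • 1) ^ p).trace ≤
      Fintype.card n * (T + s) ^ p := by
  classical
  induction p generalizing k s with
  | zero => simp [expect_const (powersetCard_nonempty.2 hk)]
  | succ p ih =>
    have hpsd (J : Finset ι) : ((sampleGram x J + (s + r) • 1) ^ p).PosSemidef :=
      ((sampleGram_posSemidef x J).add (PosSemidef.one.smul (add_nonneg hs hr0))).pow p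
    have hcross : 𝔼 I ∈ U.powersetCard k,
        ∑ i ∈ I, x i ⬝ᵥ ((sampleGram x (I.erase i) + (s + r) • 1) ^ p) *ᵥ x i ≤
          Fintype.card n * (T * (T + s) ^ p) := by
      rcases k with _ | k
      · simp only [powersetCard_zero, expect_singleton, sum_empty]
        positivity
      push_cast at hbk
      calc _ ≤ m₀ * 𝔼 J ∈ U.powersetCard k, ((sampleGram x J + (s + r) • 1) ^ p).trace :=
            expect_sum_dotProduct_mulVec_erase_le hb hk (by linarith) hpsd
        _ ≤ m₀ * (Fintype.card n * (T + (s + r)) ^ p) := by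
            gcongr
            exact ih (by omega) (add_nonneg hs hr0) (by omega) (by linarith)
        _ = Fintype.card n * (m₀ * (T + s + r) ^ p) := by rw [add_assoc]; ring
        _ ≤ Fintype.card n * (T * (T + s) ^ p) := by
            refine mul_le_mul_of_nonneg_left (mul_add_pow_le_of_mul_exp_le hr0 hm₀ hT
              (le_add_of_nonneg_right hs) hmT (by omega)) (Nat.cast_nonneg _)
    calc 𝔼 I ∈ U.powersetCard k, ((sampleGram x I + s • 1) ^ (p + 1)).trace
        ≤ s * 𝔼 I ∈ U.powersetCard k, ((sampleGram x I + s • 1) ^ p).trace +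
            Fintype.card n * (T * (T + s) ^ p) := by
          rw [mul_expect]
          refine le_trans (expect_le_expect fun I hI => trace_sampleGram_add_pow_succ_le
            (fun i hi => hr i ((mem_powersetCard.1 hI).1 hi)) hs p) ?_
          rw [expect_add_distrib]
          gcongr
      _ ≤ s * (Fintype.card n * (T + s) ^ p) + Fintype.card n * (T * (T + s) ^ p) := by
          gcongr
          exact ih (by omega) hs hk hbk
      _ = Fintype.card n * (T + s) ^ (p + 1) := by ring

omit [DecidableEq ι] in
theorem expect_trace_sampleGram_pow_le (hr0 : 0 ≤ r) (hr : ∀ i ∈ U, x i ⬝ᵥ x i ≤ r)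
    (hb0 : 0 ≤ b) (hb : ∀ z, ∑ i ∈ U, (x i ⬝ᵥ z) ^ 2 ≤ b * (z ⬝ᵥ z)) (hm₀ : 0 ≤ m₀) (hT : 0 < T)
    (hmT : m₀ * Real.exp (P * r / T) ≤ T) (hk : k ≤ #U) (hbk : b * k ≤ m₀ * (#U + 1 - k)) :
    𝔼 I ∈ U.powersetCard k, (sampleGram x I ^ P).trace ≤ Fintype.card n * T ^ P := by
  simpa using expect_trace_sampleGram_add_pow_le hr0 hr hb0 hb hm₀ hT hmT le_rfl le_rfl hk hbk

theorem div_exp_one_pow (t : ℝ) (P : ℕ) : (t / Real.exp 1) ^ P = Real.exp (-P) * t ^ P := by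
  rw [div_pow, ← Real.exp_nat_mul, mul_one, Real.exp_neg]
  ring

theorem two_mul_div_mul_le_of_two_mul_le {N : ℕ} (hk : 2 * k ≤ N) (hb : 0 ≤ b) :
    b * k ≤ 2 * b * k / N * (N + 1 - k) := by
  rcases Nat.eq_zero_or_pos N with rfl | hN
  · obtain rfl : k = 0 := by omega
    simp
  have hkN : (2 * k : ℝ) ≤ N := by exact_mod_cast hk
  rw [div_mul_eq_mul_div, le_div_iff₀ (by exact_mod_cast hN)]
  nlinarith [mul_nonneg hb (Nat.cast_nonneg (α := ℝ) k)]

omit [DecidableEq n] [DecidableEq ι] in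
theorem subsetProb_exists_lt_sum_sq_le [Fintype ι] (hr0 : 0 ≤ r) (hr : ∀ i, x i ⬝ᵥ x i ≤ r)
    (hb0 : 0 ≤ b) (hb : ∀ z, ∑ i, (x i ⬝ᵥ z) ^ 2 ≤ b * (z ⬝ᵥ z)) (ht : 0 < t)
    (hk : 2 * k ≤ Fintype.card ι)
    (hkt : 2 * b * k / Fintype.card ι * Real.exp (P * r / (t / Real.exp 1)) ≤ t / Real.exp 1) :
    subsetProb k (fun I => ∃ z, t * (z ⬝ᵥ z) < ∑ i ∈ I, (x i ⬝ᵥ z) ^ 2) ≤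
      Fintype.card n * Real.exp (-P) := by
  classical
  have hmoment : 𝔼 I ∈ univ.powersetCard k, (sampleGram x I ^ P).trace ≤
      Fintype.card n * (t / Real.exp 1) ^ P :=
    expect_trace_sampleGram_pow_le hr0 (fun i _ => hr i) hb0 hb (by positivity) (by positivity) hkt
      (by rw [card_univ]; omega) (two_mul_div_mul_le_of_two_mul_le hk hb0)
  rw [div_exp_one_pow, ← mul_assoc] at hmoment
  refine le_of_mul_le_mul_right (le_trans (subsetProb_mul_le_expect
    (fun I => ((sampleGram_posSemidef x I).pow P).trace_nonneg) ?_) hmoment) (pow_pos ht P)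
  rintro I ⟨z, hz⟩
  exact pow_le_trace_sampleGram_pow ht.le hz P

end SampleGram

section Decoupling

open Finset

variable {ι : Type*}

/-- Row `i` of `Y` with the entries outside `B` replaced by zero. -/
noncomputable def rowOn (Y : Matrix ι ι ℝ) (B : Finset ι) (i : ι) : ι → ℝ :=
  (B : Set ι).indicator (Y i)

theorem expect_powerset_notMem_and_mem [DecidableEq ι] {I : Finset ι} {i j : ι} (hi : i ∈ I)
    (hj : j ∈ I) (hij : i ≠ j) :
    𝔼 B ∈ I.powerset, (if i ∉ B ∧ j ∈ B then 1 else 0 : ℝ) = 1 / 4 := by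
  have hIcc : {B ∈ I.powerset | i ∉ B ∧ j ∈ B} = Icc {j} (I.erase i) := by
    ext B
    simp only [mem_filter, mem_powerset, mem_Icc, singleton_subset_iff,
      subset_erase]
    tauto
  have htwo : 2 ≤ #I := one_lt_card.2 ⟨i, hi, j, hj, hij⟩
  have hcard : #{B ∈ I.powerset | i ∉ B ∧ j ∈ B} = 2 ^ (#I - 2) := by
    rw [hIcc, card_Icc_finset (singleton_subset_iff.2 (mem_erase.2 ⟨hij.symm, hj⟩)),
      card_erase_of_mem hi, card_singleton, Nat.sub_sub]
  rw [expect_eq_sum_div_card, sum_boole, hcard, card_powerset]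
  push_cast
  rw [pow_sub₀ _ two_ne_zero htwo]
  field_simp
  norm_num

theorem pow_expect_le_expect_pow {κ : Type*} {s : Finset κ} (hs : s.Nonempty) (f : κ → ℝ) {p : ℕ}
    (hp : Even p) : (𝔼 a ∈ s, f a) ^ p ≤ 𝔼 a ∈ s, f a ^ p := by
  have h := Real.pow_arith_mean_le_arith_mean_pow_of_even s (fun _ => (#s : ℝ)⁻¹) f
    (fun _ _ => by positivity) (by simp [hs.ne_empty]) hp
  simpa only [expect_eq_sum_div_card, div_eq_inv_mul, mul_sum] using h

variable [Fintype ι]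

theorem rowOn_dotProduct (Y : Matrix ι ι ℝ) (B : Finset ι) (i : ι) (z : ι → ℝ) :
    rowOn Y B i ⬝ᵥ z = ∑ j ∈ B, Y i j * z j := by
  rw [dotProduct, ← sum_subset (subset_univ B) fun j _ hj => by simp [rowOn, hj]]
  exact sum_congr rfl fun j hj => by simp [rowOn, hj]

theorem rowOn_dotProduct_rowOn (Y : Matrix ι ι ℝ) (B : Finset ι) (i : ι) :
    rowOn Y B i ⬝ᵥ rowOn Y B i = ∑ j ∈ B, Y i j ^ 2 := by
  rw [rowOn_dotProduct]
  exact sum_congr rfl fun j hj => by simp [rowOn, hj, sq]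

theorem rowOn_dotProduct_eq_mulVec_indicator (Y : Matrix ι ι ℝ) (B : Finset ι) (i : ι)
    (z : ι → ℝ) : rowOn Y B i ⬝ᵥ z = (Y *ᵥ (B : Set ι).indicator z) i := by
  classical
  simp [rowOn, mulVec, dotProduct, Set.indicator_apply]

variable {Y : Matrix ι ι ℝ}

theorem dotProduct_mulVec_eq_sum_of_support_subset {I : Finset ι} {z : ι → ℝ}
    (hz : ∀ j ∉ I, z j = 0) : z ⬝ᵥ Y *ᵥ z = ∑ i ∈ I, ∑ j ∈ I, z i * (Y i j * z j) := by
  simp only [dotProduct, mulVec, mul_sum]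
  rw [← sum_subset (subset_univ I) fun i _ hi => by simp [hz i hi]]
  exact sum_congr rfl fun i _ => (sum_subset (subset_univ I) fun j _ hj => by simp [hz j hj]).symm

variable [DecidableEq ι]

theorem sum_sdiff_mul_rowOn_dotProduct {I B : Finset ι} (hB : B ⊆ I) (z : ι → ℝ) :
    ∑ i ∈ I \ B, z i * (rowOn Y B i ⬝ᵥ z) =
      ∑ i ∈ I, ∑ j ∈ I, (if i ∉ B ∧ j ∈ B then 1 else 0) * (z i * (Y i j * z j)) := by
  rw [sdiff_eq_filter, sum_filter]
  refine sum_congr rfl fun i _ => ?_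
  by_cases hi : i ∈ B
  · simp [hi]
  · simp [hi, rowOn_dotProduct, mul_sum, inter_eq_right.2 hB]

theorem dotProduct_mulVec_eq_four_mul_expect (hY : ∀ i, Y i i = 0) {I : Finset ι} {z : ι → ℝ}
    (hz : ∀ j ∉ I, z j = 0) :
    z ⬝ᵥ Y *ᵥ z = 4 * 𝔼 B ∈ I.powerset, ∑ i ∈ I \ B, z i * (rowOn Y B i ⬝ᵥ z) := by
  rw [expect_congr rfl fun B hB => sum_sdiff_mul_rowOn_dotProduct (mem_powerset.1 hB) z,
    expect_sum_comm, dotProduct_mulVec_eq_sum_of_support_subset hz, mul_sum]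
  refine sum_congr rfl fun i hi => ?_
  rw [expect_sum_comm, mul_sum]
  refine sum_congr rfl fun j hj => ?_
  rw [← expect_mul]
  rcases eq_or_ne i j with rfl | hij
  · simp [hY]
  · rw [expect_powerset_notMem_and_mem hi hj hij]
    ring

theorem dotProduct_mulVec_pow_le_pow_mul_trace_pow {A : Matrix ι ι ℝ} (hA : A.PosSemidef)
    {z : ι → ℝ} (hz : z ≠ 0) (P : ℕ) :
    (z ⬝ᵥ A *ᵥ z) ^ P ≤ (z ⬝ᵥ z) ^ P * (A ^ P).trace := by
  have hzz : 0 < z ⬝ᵥ z := by simpa using dotProduct_star_self_pos_iff.2 hz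
  have hzA : 0 ≤ z ⬝ᵥ A *ᵥ z := by simpa using hA.dotProduct_mulVec_nonneg z
  have h := pow_le_trace_pow hA (div_nonneg hzA hzz.le) hz (div_mul_cancel₀ _ hzz.ne').le P
  rwa [div_pow, div_le_iff₀' (pow_pos hzz P)] at h

theorem sum_sdiff_mul_rowOn_dotProduct_pow_le (Y : Matrix ι ι ℝ) (I B : Finset ι) {z : ι → ℝ}
    (hz : z ≠ 0) (P : ℕ) : (∑ i ∈ I \ B, z i * (rowOn Y B i ⬝ᵥ z)) ^ (2 * P) ≤
      (z ⬝ᵥ z) ^ (2 * P) * (sampleGram (rowOn Y B) (I \ B) ^ P).trace := by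
  have hsq : (∑ i ∈ I \ B, z i * (rowOn Y B i ⬝ᵥ z)) ^ 2 ≤
      (z ⬝ᵥ z) * (z ⬝ᵥ sampleGram (rowOn Y B) (I \ B) *ᵥ z) := by
    rw [dotProduct_sampleGram_mulVec]
    refine (sum_mul_sq_le_sq_mul_sq _ _ _).trans ?_
    gcongr
    simp only [dotProduct, ← sq]
    exact sum_le_sum_of_subset_of_nonneg (subset_univ _) fun _ _ _ => sq_nonneg _
  calc _ ≤ ((z ⬝ᵥ z) * (z ⬝ᵥ sampleGram (rowOn Y B) (I \ B) *ᵥ z)) ^ P := by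
        rw [pow_mul]
        gcongr
    _ ≤ (z ⬝ᵥ z) ^ P * ((z ⬝ᵥ z) ^ P * (sampleGram (rowOn Y B) (I \ B) ^ P).trace) := by
        rw [mul_pow]
        refine mul_le_mul_of_nonneg_left (dotProduct_mulVec_pow_le_pow_mul_trace_pow
          (sampleGram_posSemidef _ _) hz P) (pow_nonneg ?_ P)
        simpa using dotProduct_star_self_nonneg z
    _ = _ := by ring

theorem pow_le_mul_expect_trace_sampleGram_rowOn (hY : ∀ i, Y i i = 0) {I : Finset ι} {z : ι → ℝ}
    (hz : ∀ j ∉ I, z j = 0) {s : ℝ} (hs : 0 ≤ s) (hsz : s * (z ⬝ᵥ z) < |z ⬝ᵥ Y *ᵥ z|) (P : ℕ) :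
    s ^ (2 * P) ≤
      16 ^ P * 𝔼 B ∈ I.powerset, (sampleGram (rowOn Y B) (I \ B) ^ P).trace := by
  have hz0 : z ≠ 0 := by
    rintro rfl
    simp at hsz
  have hzz : 0 < z ⬝ᵥ z := by simpa using dotProduct_star_self_pos_iff.2 hz0
  refine le_of_mul_le_mul_right ?_ (pow_pos hzz (2 * P))
  calc s ^ (2 * P) * (z ⬝ᵥ z) ^ (2 * P) ≤ (z ⬝ᵥ Y *ᵥ z) ^ (2 * P) := by
        rw [← mul_pow, ← (even_two_mul P).pow_abs (z ⬝ᵥ Y *ᵥ z)]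
        gcongr
    _ = 16 ^ P * (𝔼 B ∈ I.powerset, ∑ i ∈ I \ B, z i * (rowOn Y B i ⬝ᵥ z)) ^ (2 * P) := by
        rw [dotProduct_mulVec_eq_four_mul_expect hY hz, mul_pow, pow_mul]
        norm_num
    _ ≤ 16 ^ P * 𝔼 B ∈ I.powerset, (∑ i ∈ I \ B, z i * (rowOn Y B i ⬝ᵥ z)) ^ (2 * P) := by
        gcongr
        exact pow_expect_le_expect_pow (powerset_nonempty I) _ (even_two_mul P)
    _ ≤ 16 ^ P * 𝔼 B ∈ I.powerset,
          (z ⬝ᵥ z) ^ (2 * P) * (sampleGram (rowOn Y B) (I \ B) ^ P).trace := by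
        gcongr
        exact sum_sdiff_mul_rowOn_dotProduct_pow_le Y I _ hz0 P
    _ = _ := by
        rw [← mul_expect]
        ring

theorem sum_powersetCard_sum_powerset {M : Type*} [AddCommMonoid M] (k : ℕ)
    (f : Finset ι → Finset ι → M) :
    ∑ I ∈ univ.powersetCard k, ∑ B ∈ I.powerset, f (I \ B) B =
      ∑ B with #B ≤ k, ∑ A ∈ Bᶜ.powersetCard (k - #B), f A B := by
  rw [sum_sigma', sum_sigma']
  refine sum_bij' (fun p _ => ⟨p.2, p.1 \ p.2⟩) (fun q _ => ⟨q.2 ∪ q.1, q.1⟩) ?_ ?_ ?_ ?_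
    fun _ _ => rfl
  · rintro ⟨I, B⟩ h
    simp only [mem_sigma, mem_powerset, mem_filter_univ, mem_powersetCard, subset_univ,
      true_and] at h ⊢
    refine ⟨h.1 ▸ card_le_card h.2, fun a ha => by simpa using (mem_sdiff.1 ha).2, ?_⟩
    rw [card_sdiff_of_subset h.2, h.1]
  · rintro ⟨B, A⟩ h
    simp only [mem_sigma, mem_powerset, mem_filter_univ, mem_powersetCard, subset_univ,
      true_and] at h ⊢
    refine ⟨?_, subset_union_right⟩
    rw [card_union_of_disjoint (subset_compl_iff_disjoint_right.1 h.2.1), h.2.2]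
    omega
  · rintro ⟨I, B⟩ h
    simp only [mem_sigma, mem_powerset] at h
    simp [sdiff_union_of_subset h.2]
  · rintro ⟨B, A⟩ h
    simp only [mem_sigma, mem_powersetCard] at h
    simp [union_sdiff_cancel_right (subset_compl_iff_disjoint_right.1 h.2.1)]

omit [DecidableEq ι] in
theorem expect_expect_powerset (k : ℕ) (g : Finset ι → Finset ι → ℝ) :
    𝔼 I ∈ univ.powersetCard k, 𝔼 B ∈ I.powerset, g I B =
      (∑ I ∈ univ.powersetCard k, ∑ B ∈ I.powerset, g I B) /
        (2 ^ k * #((univ : Finset ι).powersetCard k)) := by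
  rw [expect_eq_sum_div_card, ← div_div, sum_div _ _ (2 ^ k : ℝ)]
  congr 1
  refine sum_congr rfl fun I hI => ?_
  rw [expect_eq_sum_div_card, card_powerset, (mem_powersetCard.1 hI).2]
  norm_cast

theorem expect_expect_powerset_le {k : ℕ} (hk : k ≤ Fintype.card ι) {f : Finset ι → Finset ι → ℝ}
    {c : ℝ} (h : ∀ B, #B ≤ k → 𝔼 A ∈ Bᶜ.powersetCard (k - #B), f A B ≤ c) :
    𝔼 I ∈ univ.powersetCard k, 𝔼 B ∈ I.powerset, f (I \ B) B ≤ c := by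
  calc 𝔼 I ∈ univ.powersetCard k, 𝔼 B ∈ I.powerset, f (I \ B) B
      ≤ 𝔼 I ∈ (univ : Finset ι).powersetCard k, 𝔼 _B ∈ I.powerset, c := by
        rw [expect_expect_powerset, expect_expect_powerset k fun _ _ => c,
          sum_powersetCard_sum_powerset, sum_powersetCard_sum_powerset k fun _ _ => c]
        refine div_le_div_of_nonneg_right (sum_le_sum fun B hB => ?_) (by positivity)
        rw [sum_const, nsmul_eq_mul, ← card_mul_expect]
        gcongr
        exact h B ((mem_filter_univ B).1 hB)
    _ = c := by
        simp only [expect_const (powerset_nonempty _)]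
        exact expect_const (powersetCard_nonempty.2 hk) c

/-- The index sets `I` on which all rows of `Y` are short, and whose columns form a matrix of
squared norm at most `b`. For such `I` the rows of `Y` restricted to `I` are short vectors to which
the trace moment bound applies. -/
def Regular (Y : Matrix ι ι ℝ) (r b : ℝ) (I : Finset ι) : Prop :=
  (∀ i, ∑ j ∈ I, Y i j ^ 2 ≤ r) ∧
    ∀ z : ι → ℝ, (∀ j ∉ I, z j = 0) → (Y *ᵥ z) ⬝ᵥ (Y *ᵥ z) ≤ b * (z ⬝ᵥ z)

variable {r b : ℝ} {k P : ℕ} {B I : Finset ι}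

omit [DecidableEq ι] in
theorem Regular.mono (h : Regular Y r b I) (hB : B ⊆ I) : Regular Y r b B :=
  ⟨fun i => (sum_le_sum_of_subset_of_nonneg hB fun _ _ _ => sq_nonneg _).trans (h.1 i),
    fun z hz => h.2 z fun j hj => hz j fun hjB => hj (hB hjB)⟩

omit [DecidableEq ι] in
theorem dotProduct_indicator_le (z : ι → ℝ) (B : Finset ι) :
    (B : Set ι).indicator z ⬝ᵥ (B : Set ι).indicator z ≤ z ⬝ᵥ z := by
  refine sum_le_sum fun j _ => ?_
  by_cases hj : j ∈ B <;> simp [hj, mul_self_nonneg]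

omit [DecidableEq ι] in
theorem Regular.sum_rowOn_dotProduct_sq_le (hB : Regular Y r b B) (hb : 0 ≤ b) (U : Finset ι)
    (z : ι → ℝ) : ∑ i ∈ U, (rowOn Y B i ⬝ᵥ z) ^ 2 ≤ b * (z ⬝ᵥ z) := by
  calc ∑ i ∈ U, (rowOn Y B i ⬝ᵥ z) ^ 2 ≤ ∑ i, (rowOn Y B i ⬝ᵥ z) ^ 2 :=
        sum_le_sum_of_subset_of_nonneg (subset_univ _) fun _ _ _ => sq_nonneg _
    _ = (Y *ᵥ (B : Set ι).indicator z) ⬝ᵥ (Y *ᵥ (B : Set ι).indicator z) :=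
        sum_congr rfl fun i _ => by rw [rowOn_dotProduct_eq_mulVec_indicator, sq]
    _ ≤ b * ((B : Set ι).indicator z ⬝ᵥ (B : Set ι).indicator z) :=
        hB.2 _ fun j hj => by simp [hj]
    _ ≤ b * (z ⬝ᵥ z) := by
        gcongr
        exact dotProduct_indicator_le z B

theorem Regular.expect_trace_sampleGram_le {m₀ T : ℝ} (hB : Regular Y r b B) (hr : 0 ≤ r)
    (hb : 0 ≤ b) (hm₀ : 0 ≤ m₀) (hT : 0 < T) (hk : k ≤ Fintype.card ι) (hBk : #B ≤ k)
    (hbk : b * k ≤ m₀ * (Fintype.card ι + 1 - k)) (hmT : m₀ * Real.exp (P * r / T) ≤ T) :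
    𝔼 A ∈ Bᶜ.powersetCard (k - #B), (sampleGram (rowOn Y B) A ^ P).trace ≤
      Fintype.card ι * T ^ P := by
  refine expect_trace_sampleGram_pow_le hr (fun i _ => ?_) hb
    (hB.sum_rowOn_dotProduct_sq_le hb _) hm₀ hT hmT ?_ ?_
  · rw [rowOn_dotProduct_rowOn]
    exact hB.1 i
  · rw [card_compl]
    omega
  · rw [card_compl, Nat.cast_sub (hBk.trans hk), Nat.cast_sub hBk]
    linarith [mul_nonneg hb (Nat.cast_nonneg (α := ℝ) #B)]

open Classical in
theorem expect_expect_trace_of_regular_le {T : ℝ} (hr : 0 ≤ r) (hb : 0 ≤ b) (hT : 0 < T)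
    (hk : 2 * k ≤ Fintype.card ι)
    (hkT : 2 * b * k / Fintype.card ι * Real.exp (P * r / T) ≤ T) :
    𝔼 I ∈ univ.powersetCard k, 𝔼 B ∈ I.powerset,
      (if Regular Y r b B then (sampleGram (rowOn Y B) (I \ B) ^ P).trace else 0) ≤
        Fintype.card ι * T ^ P := by
  refine expect_expect_powerset_le (by omega)
    (f := fun A B => if Regular Y r b B then (sampleGram (rowOn Y B) A ^ P).trace else 0)
    fun B hBk => ?_
  by_cases hB : Regular Y r b B
  · simp only [hB, if_true]
    exact hB.expect_trace_sampleGram_le hr hb (by positivity) hT (by omega) hBk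
      (two_mul_div_mul_le_of_two_mul_le hk hb) hkT
  · simp only [hB, if_false, expect_const_zero]
    positivity

omit [DecidableEq ι] in
theorem subsetProb_regular_and_exists_lt_le (hY : ∀ i, Y i i = 0) {s : ℝ} (hr : 0 ≤ r)
    (hb : 0 ≤ b) (hs : 0 < s) (hk : 2 * k ≤ Fintype.card ι)
    (hks : 2 * b * k / Fintype.card ι * Real.exp (P * r / (s ^ 2 / 16 / Real.exp 1)) ≤
      s ^ 2 / 16 / Real.exp 1) :
    subsetProb k (fun I => Regular Y r b I ∧
        ∃ z, (∀ j ∉ I, z j = 0) ∧ s * (z ⬝ᵥ z) < |z ⬝ᵥ Y *ᵥ z|) ≤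
      Fintype.card ι * Real.exp (-P) := by
  classical
  set τ : Finset ι → Finset ι → ℝ := fun I B =>
    if Regular Y r b B then (sampleGram (rowOn Y B) (I \ B) ^ P).trace else 0 with hτ
  have hτ0 (I B) : 0 ≤ τ I B := by
    simp only [hτ]
    split_ifs
    exacts [((sampleGram_posSemidef _ _).pow P).trace_nonneg, le_rfl]
  refine le_of_mul_le_mul_right ?_ (pow_pos hs (2 * P))
  calc _ ≤ 𝔼 I ∈ univ.powersetCard k, 16 ^ P * 𝔼 B ∈ I.powerset, τ I B := by
        refine subsetProb_mul_le_expect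
          (fun I => mul_nonneg (by positivity) (expect_nonneg fun B _ => hτ0 I B)) ?_
        rintro I ⟨hI, z, hz, hsz⟩
        rw [expect_congr rfl fun B hB => if_pos (hI.mono (mem_powerset.1 hB))]
        exact pow_le_mul_expect_trace_sampleGram_rowOn hY hz hs.le hsz P
    _ ≤ 16 ^ P * (Fintype.card ι * (s ^ 2 / 16 / Real.exp 1) ^ P) := by
        rw [← mul_expect]
        gcongr
        exact expect_expect_trace_of_regular_le hr hb (by positivity) hk hks
    _ = Fintype.card ι * Real.exp (-P) * s ^ (2 * P) := by
        rw [div_exp_one_pow, div_pow, ← pow_mul]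
        field_simp

omit [DecidableEq ι] in
theorem subsetProb_exists_lt_sum_apply_sq_le {t : ℝ} (hr : 0 ≤ r) (hYr : ∀ i j, Y i j ^ 2 ≤ r)
    (hb : 0 ≤ b) (hYb : ∀ i, ∑ j, Y i j ^ 2 ≤ b) (ht : 0 < t) (hk : 2 * k ≤ Fintype.card ι)
    (hkt : 2 * b * k / Fintype.card ι * Real.exp (P * r / (t / Real.exp 1)) ≤ t / Real.exp 1) :
    subsetProb k (fun I => ∃ i, t < ∑ j ∈ I, Y i j ^ 2) ≤ Fintype.card ι * Real.exp (-P) := by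
  refine subsetProb_exists_le fun i => ?_
  have h := subsetProb_exists_lt_sum_sq_le (n := Unit) (x := fun j _ => Y i j) hr
    (fun j => by simpa [dotProduct, sq] using hYr i j) hb
    (fun z => by
      simp only [dotProduct, univ_unique, sum_singleton, mul_pow, ← sum_mul, ← sq]
      exact mul_le_mul_of_nonneg_right (hYb i) (sq_nonneg _)) ht hk hkt
  rw [Fintype.card_unit, Nat.cast_one, one_mul] at h
  refine (subsetProb_mono fun I _ hI => ?_).trans h
  exact ⟨fun _ => 1, by simpa [dotProduct] using hI⟩

omit [DecidableEq ι] in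
theorem dotProduct_mulVec_self_le_of_sum_mulVec_sq_le (hY : Y.IsSymm) {t : ℝ}
    (h : ∀ w, ∑ i ∈ I, (Y i ⬝ᵥ w) ^ 2 ≤ t * (w ⬝ᵥ w)) {z : ι → ℝ} (hz : ∀ j ∉ I, z j = 0) :
    (Y *ᵥ z) ⬝ᵥ (Y *ᵥ z) ≤ t * (z ⬝ᵥ z) := by
  set w := Y *ᵥ z with hw
  have hww : w ⬝ᵥ w = ∑ i ∈ I, (Y i ⬝ᵥ w) * z i := by
    calc w ⬝ᵥ w = (Y *ᵥ w) ⬝ᵥ z := by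
          rw [hw, dotProduct_mulVec, ← mulVec_transpose, hY]
      _ = ∑ i ∈ I, (Y i ⬝ᵥ w) * z i :=
          (sum_subset (subset_univ I) fun i _ hi => by simp [hz i hi]).symm
  have hzI : ∑ i ∈ I, z i ^ 2 = z ⬝ᵥ z := by
    rw [sum_subset (subset_univ I) fun i _ hi => by simp [hz i hi]]
    simp only [dotProduct, sq]
  have hsq : (w ⬝ᵥ w) * (w ⬝ᵥ w) ≤ (w ⬝ᵥ w) * (t * (z ⬝ᵥ z)) := by
    calc (w ⬝ᵥ w) * (w ⬝ᵥ w) = (∑ i ∈ I, (Y i ⬝ᵥ w) * z i) ^ 2 := by rw [← hww, sq]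
      _ ≤ (∑ i ∈ I, (Y i ⬝ᵥ w) ^ 2) * ∑ i ∈ I, z i ^ 2 := sum_mul_sq_le_sq_mul_sq _ _ _
      _ ≤ t * (w ⬝ᵥ w) * (z ⬝ᵥ z) := by
          rw [hzI]
          gcongr
          · simpa using dotProduct_star_self_nonneg z
          · exact h w
      _ = _ := by ring
  rcases eq_or_ne w 0 with h0 | h0
  · rw [h0, zero_dotProduct]
    exact (sum_nonneg fun _ _ => sq_nonneg _).trans (h z)
  · exact le_of_mul_le_mul_left hsq (by simpa using dotProduct_star_self_pos_iff.2 h0)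

omit [DecidableEq ι] in
theorem subsetProb_exists_lt_mulVec_le (hY : Y.IsSymm) {t : ℝ} (hr : 0 ≤ r)
    (hYr : ∀ i, ∑ j, Y i j ^ 2 ≤ r) (hb : 0 ≤ b)
    (hYb : ∀ z, (Y *ᵥ z) ⬝ᵥ (Y *ᵥ z) ≤ b * (z ⬝ᵥ z)) (ht : 0 < t) (hk : 2 * k ≤ Fintype.card ι)
    (hkt : 2 * b * k / Fintype.card ι * Real.exp (P * r / (t / Real.exp 1)) ≤ t / Real.exp 1) :
    subsetProb k (fun I => ∃ z, (∀ j ∉ I, z j = 0) ∧ t * (z ⬝ᵥ z) < (Y *ᵥ z) ⬝ᵥ (Y *ᵥ z)) ≤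
      Fintype.card ι * Real.exp (-P) := by
  refine le_trans (subsetProb_mono fun I _ hI => ?_) (subsetProb_exists_lt_sum_sq_le
    (x := fun i => Y i) hr (fun i => by simpa [dotProduct, sq] using hYr i) hb
    (fun z => by simpa [dotProduct, mulVec, sq] using hYb z) ht hk hkt)
  obtain ⟨z, hz, hlt⟩ := hI
  by_contra! hI
  exact hlt.not_ge (dotProduct_mulVec_self_le_of_sum_mulVec_sq_le hY hI hz)

end Decoupling

section LeastSquares

variable {m n : Type*} [Fintype m] [Fintype n]

theorem dotProduct_mulVec_eq_sum_col (Φ : Matrix m n ℝ) (h : m → ℝ) (w : n → ℝ) :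
    h ⬝ᵥ Φ *ᵥ w = ∑ j, (Φ.col j ⬝ᵥ h) * w j := by
  rw [dotProduct_mulVec, ← mulVec_transpose]
  rfl

theorem dotProduct_extend_zero {J : Finset n} (v : n → ℝ) (z : J → ℝ) :
    v ⬝ᵥ Function.extend Subtype.val z 0 = (fun i : J => v i) ⬝ᵥ z := by
  classical
  have hextend : ∀ i : J, Function.extend Subtype.val z 0 (i : n) = z i :=
    Subtype.val_injective.extend_apply z 0
  have hzero : ∀ j ∉ J, Function.extend Subtype.val z 0 j = 0 := fun j hj =>
    Function.extend_apply' z (0 : n → ℝ) j fun ⟨i, hi⟩ => hj (hi ▸ i.2)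
  calc ∑ j, v j * Function.extend Subtype.val z 0 j
      = ∑ j ∈ J, v j * Function.extend Subtype.val z 0 j :=
        (Finset.sum_subset J.subset_univ fun j _ hj => by rw [hzero j hj, mul_zero]).symm
    _ = ∑ i : J, v i * z i := by
        rw [← Finset.sum_coe_sort J]
        exact Finset.sum_congr rfl fun i _ => by rw [hextend]

theorem mul_dotProduct_self_le_gram_submatrix {Φ : Matrix m n ℝ} {J : Finset n} {c : ℝ}
    (hΦ : ∀ z : n → ℝ, (∀ j ∉ J, z j = 0) → c * (z ⬝ᵥ z) ≤ (Φ *ᵥ z) ⬝ᵥ (Φ *ᵥ z)) (z : J → ℝ) :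
    c * (z ⬝ᵥ z) ≤
      z ⬝ᵥ ((Φ.submatrix id ((↑) : J → n))ᵀ * Φ.submatrix id ((↑) : J → n)) *ᵥ z := by
  set y : n → ℝ := Function.extend Subtype.val z 0
  have hyJ : (fun i : J => y i) = z := funext (Subtype.val_injective.extend_apply z 0)
  have hzero : ∀ j ∉ J, y j = 0 := fun j hj =>
    Function.extend_apply' z (0 : n → ℝ) j fun ⟨i, hi⟩ => hj (hi ▸ i.2)
  have hyy : y ⬝ᵥ y = z ⬝ᵥ z := (dotProduct_extend_zero y z).trans (by rw [hyJ])
  have hΦy : Φ *ᵥ y = Φ.submatrix id (↑) *ᵥ z := funext fun i => dotProduct_extend_zero (Φ i) z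
  rw [← hyy, ← mulVec_mulVec, dotProduct_mulVec, ← mulVec_transpose, transpose_transpose, ← hΦy]
  exact hΦ y hzero

variable [DecidableEq n]

section Coercive

variable {A : Matrix n n ℝ} {c : ℝ}

theorem isUnit_of_mul_dotProduct_self_le (hc : 0 < c)
    (hA : ∀ z, c * (z ⬝ᵥ z) ≤ z ⬝ᵥ A *ᵥ z) : IsUnit A := by
  rw [← mulVec_injective_iff_isUnit, ← coe_mulVecLin, ← LinearMap.ker_eq_bot, LinearMap.ker_eq_bot']
  intro z hz
  have hz' : c * (z ⬝ᵥ z) ≤ 0 := by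
    simpa only [show A *ᵥ z = 0 from hz, dotProduct_zero] using hA z
  have hnonneg : 0 ≤ z ⬝ᵥ z := by simpa using dotProduct_star_self_nonneg z
  exact dotProduct_self_eq_zero.1 (le_antisymm (nonpos_of_mul_nonpos_right hz' hc) hnonneg)

theorem sq_mul_dotProduct_inv_mulVec_self_le (hc : 0 < c)
    (hA : ∀ z, c * (z ⬝ᵥ z) ≤ z ⬝ᵥ A *ᵥ z) (v : n → ℝ) :
    c ^ 2 * ((A⁻¹ *ᵥ v) ⬝ᵥ (A⁻¹ *ᵥ v)) ≤ v ⬝ᵥ v := by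
  set u := A⁻¹ *ᵥ v with hu
  have hAu : A *ᵥ u = v := by
    have hdet := (isUnit_iff_isUnit_det A).1 (isUnit_of_mul_dotProduct_self_le hc hA)
    rw [hu, mulVec_mulVec, mul_nonsing_inv _ hdet, one_mulVec]
  have hlow : c * (u ⬝ᵥ u) ≤ u ⬝ᵥ v := hAu ▸ hA u
  have hnonneg : 0 ≤ (v - c • u) ⬝ᵥ (v - c • u) := by
    simpa using dotProduct_star_self_nonneg (v - c • u)
  simp only [sub_dotProduct, dotProduct_sub, smul_dotProduct, dotProduct_smul, smul_eq_mul,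
    dotProduct_comm v u] at hnonneg
  nlinarith

end Coercive

/-- The solution `h` of `Ψᵀ h = s` of least Euclidean norm. It is a genuine solution only if the
columns of `Ψ` are linearly independent. -/
noncomputable def leastSquaresCertificate (Ψ : Matrix m n ℝ) (s : n → ℝ) : m → ℝ :=
  Ψ *ᵥ ((Ψᵀ * Ψ)⁻¹ *ᵥ s)

/-- The coefficients of the orthogonal projection of `v` to the span of the columns of `Ψ`. They
are the weights with which the signs `s` enter the inner product of `v` and the least-squares
certificate of `s`. -/
noncomputable def certificateWeights (Ψ : Matrix m n ℝ) (v : m → ℝ) : n → ℝ :=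
  (Ψᵀ * Ψ)⁻¹ *ᵥ (Ψᵀ *ᵥ v)

theorem transpose_mulVec_leastSquaresCertificate {Ψ : Matrix m n ℝ} (hΨ : IsUnit (Ψᵀ * Ψ))
    (s : n → ℝ) : Ψᵀ *ᵥ leastSquaresCertificate Ψ s = s := by
  rw [leastSquaresCertificate, mulVec_mulVec, mulVec_mulVec,
    mul_nonsing_inv _ ((isUnit_iff_isUnit_det _).1 hΨ), one_mulVec]

theorem dotProduct_leastSquaresCertificate (Ψ : Matrix m n ℝ) (v : m → ℝ) (s : n → ℝ) :
    v ⬝ᵥ leastSquaresCertificate Ψ s = certificateWeights Ψ v ⬝ᵥ s := by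
  rw [leastSquaresCertificate, certificateWeights, dotProduct_mulVec, ← mulVec_transpose,
    dotProduct_mulVec, ← mulVec_transpose, transpose_nonsing_inv, transpose_mul,
    transpose_transpose]

theorem sq_mul_dotProduct_certificateWeights_self_le {Φ : Matrix m n ℝ} {J : Finset n} {c : ℝ}
    (hc : 0 < c) (hΦ : ∀ z : n → ℝ, (∀ j ∉ J, z j = 0) → c * (z ⬝ᵥ z) ≤ (Φ *ᵥ z) ⬝ᵥ (Φ *ᵥ z))
    (v : m → ℝ) :
    c ^ 2 * (certificateWeights (Φ.submatrix id ((↑) : J → n)) v ⬝ᵥ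
        certificateWeights (Φ.submatrix id ((↑) : J → n)) v) ≤
      ∑ i ∈ J, (v ⬝ᵥ Φ.col i) ^ 2 := by
  refine (sq_mul_dotProduct_inv_mulVec_self_le hc
    (mul_dotProduct_self_le_gram_submatrix hΦ) _).trans_eq ?_
  rw [← Finset.sum_coe_sort J]
  refine Finset.sum_congr rfl fun i _ => ?_
  rw [sq, dotProduct_comm v]
  rfl

end LeastSquares

section Certificate

variable {m N : ℕ} {Φ : Matrix (Fin m) (Fin N) ℝ} {h : Fin m → ℝ} {x : Fin N → ℝ}
  {J : Finset (Fin N)}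

theorem sign_mul_self_eq_abs (a : ℝ) : Real.sign a * a = |a| := by
  rcases lt_trichotomy a 0 with ha | rfl | ha
  · rw [Real.sign_of_neg ha, abs_of_neg ha, neg_one_mul]
  · simp
  · rw [Real.sign_of_pos ha, abs_of_pos ha, one_mul]

theorem dotProduct_mulVec_le_l1norm (hh : ∀ j, |Φ.col j ⬝ᵥ h| ≤ 1) (w : Fin N → ℝ) :
    h ⬝ᵥ Φ *ᵥ w ≤ l1norm w := by
  rw [dotProduct_mulVec_eq_sum_col]
  refine Finset.sum_le_sum fun j _ => (le_abs_self _).trans ?_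
  rw [abs_mul]
  exact mul_le_of_le_one_left (abs_nonneg _) (hh j)

theorem apply_eq_zero_of_l1norm_le_dotProduct_mulVec (hh : ∀ j, |Φ.col j ⬝ᵥ h| ≤ 1)
    {w : Fin N → ℝ} (hw : l1norm w ≤ h ⬝ᵥ Φ *ᵥ w) {j : Fin N} (hj : |Φ.col j ⬝ᵥ h| < 1) :
    w j = 0 := by
  by_contra hne
  have hle : ∀ i, |(Φ.col i ⬝ᵥ h) * w i| ≤ |w i| := fun i => by
    rw [abs_mul]
    exact mul_le_of_le_one_left (abs_nonneg _) (hh i)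
  have hlt : |(Φ.col j ⬝ᵥ h) * w j| < |w j| := by
    rw [abs_mul]
    exact mul_lt_of_lt_one_left (abs_pos.2 hne) hj
  rw [dotProduct_mulVec_eq_sum_col] at hw
  exact hw.not_gt (Finset.sum_lt_sum (fun i _ => (le_abs_self _).trans (hle i))
    ⟨j, Finset.mem_univ j, (le_abs_self _).trans_lt hlt⟩)

theorem bpRecovers_of_dual_certificate (hx : ∀ j ∉ J, x j = 0)
    (hinj : ∀ z : Fin N → ℝ, (∀ j ∉ J, z j = 0) → Φ *ᵥ z = 0 → z = 0)
    (hsign : ∀ i ∈ J, Φ.col i ⬝ᵥ h = Real.sign (x i)) (hlt : ∀ j ∉ J, |Φ.col j ⬝ᵥ h| < 1) :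
    BPRecovers Φ x := by
  have hle : ∀ j, |Φ.col j ⬝ᵥ h| ≤ 1 := fun j => by
    by_cases hj : j ∈ J
    · rw [hsign j hj]
      rcases Real.sign_apply_eq (x j) with hs | hs | hs <;> simp [hs]
    · exact (hlt j hj).le
  have hl1 : l1norm x = h ⬝ᵥ Φ *ᵥ x := by
    rw [dotProduct_mulVec_eq_sum_col]
    refine Finset.sum_congr rfl fun j _ => ?_
    by_cases hj : j ∈ J
    · rw [hsign j hj, sign_mul_self_eq_abs]
    · simp [hx j hj]
  refine Set.eq_singleton_iff_unique_mem.2 ⟨⟨rfl, fun w hw => ?_⟩, fun w ⟨hw, hmin⟩ => ?_⟩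
  · rw [hl1, ← hw]
    exact dotProduct_mulVec_le_l1norm hle w
  · have hwl1 : l1norm w ≤ h ⬝ᵥ Φ *ᵥ w := by
      rw [hw, ← hl1]
      exact hmin x rfl
    refine sub_eq_zero.1 (hinj (w - x) (fun j hj => ?_) (by rw [mulVec_sub, hw, sub_self]))
    rw [Pi.sub_apply, apply_eq_zero_of_l1norm_le_dotProduct_mulVec hle hwl1 (hlt j hj), hx j hj,
      sub_zero]

theorem bpRecovers_of_abs_certificateWeights_lt {c : ℝ} (hc : 0 < c)
    (hΦ : ∀ z : Fin N → ℝ, (∀ j ∉ J, z j = 0) → c * (z ⬝ᵥ z) ≤ (Φ *ᵥ z) ⬝ᵥ (Φ *ᵥ z))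
    (hx : ∀ j ∉ J, x j = 0)
    (hlt : ∀ j ∉ J, |certificateWeights (Φ.submatrix id ((↑) : J → Fin N)) (Φ.col j) ⬝ᵥ
      fun i => Real.sign (x i)| < 1) :
    BPRecovers Φ x := by
  set Ψ := Φ.submatrix id ((↑) : J → Fin N)
  have hunit : IsUnit (Ψᵀ * Ψ) :=
    isUnit_of_mul_dotProduct_self_le hc (mul_dotProduct_self_le_gram_submatrix hΦ)
  refine bpRecovers_of_dual_certificate
    (h := leastSquaresCertificate Ψ fun i : J => Real.sign (x i)) hx (fun z hz hΦz => ?_)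
    (fun i hi => congrFun (transpose_mulVec_leastSquaresCertificate hunit _) ⟨i, hi⟩) fun j hj => ?_
  · have hcz : c * (z ⬝ᵥ z) ≤ 0 := by simpa only [hΦz, dotProduct_zero] using hΦ z hz
    have hnonneg : 0 ≤ z ⬝ᵥ z := by simpa using dotProduct_star_self_nonneg z
    exact dotProduct_self_eq_zero.1 (le_antisymm (nonpos_of_mul_nonpos_right hcz hc) hnonneg)
  · rw [dotProduct_leastSquaresCertificate]
    exact hlt j hj

end Certificate

section Rademacher

open scoped NNReal

variable {Ω κ : Type*} [MeasurableSpace Ω] {Q : Measure Ω}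

/-- `σ` takes each of the values `1` and `-1` with probability `1/2`. -/
def IsRademacher (Q : Measure Ω) (σ : Ω → ℝ) : Prop :=
  Q {ω | σ ω = 1} = 2⁻¹ ∧ Q {ω | σ ω = -1} = 2⁻¹

namespace IsRademacher

variable [IsProbabilityMeasure Q] {σ : Ω → ℝ}

theorem ae_eq_one_or_eq_neg_one (h : IsRademacher Q σ) (hσ : Measurable σ) :
    ∀ᵐ ω ∂Q, σ ω = 1 ∨ σ ω = -1 := by
  have hpos : MeasurableSet {ω | σ ω = 1} := hσ (measurableSet_singleton 1)
  have hneg : MeasurableSet {ω | σ ω = -1} := hσ (measurableSet_singleton (-1))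
  have hdisj : Disjoint {ω | σ ω = 1} {ω | σ ω = -1} :=
    Set.disjoint_left.2 fun ω h1 h2 => by
      have : (1 : ℝ) = -1 := h1.symm.trans h2
      norm_num at this
  have hunion := measure_union (μ := Q) hdisj hneg
  rw [h.1, h.2, ENNReal.inv_two_add_inv_two] at hunion
  exact (prob_compl_eq_zero_iff (hpos.union hneg)).2 hunion

theorem integral_eq_zero (h : IsRademacher Q σ) (hσ : Measurable σ) : ∫ ω, σ ω ∂Q = 0 := by
  have hpos : MeasurableSet {ω | σ ω = 1} := hσ (measurableSet_singleton 1)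
  have hneg : MeasurableSet {ω | σ ω = -1} := hσ (measurableSet_singleton (-1))
  have hindicator : σ =ᵐ[Q] fun ω => {ω | σ ω = 1}.indicator (fun _ => (1 : ℝ)) ω -
      {ω | σ ω = -1}.indicator (fun _ => (1 : ℝ)) ω := by
    filter_upwards [h.ae_eq_one_or_eq_neg_one hσ] with ω hω
    rcases hω with hω | hω <;> norm_num [Set.indicator, hω]
  rw [integral_congr_ae hindicator,
    integral_sub ((integrable_const _).indicator hpos) ((integrable_const _).indicator hneg),
    integral_indicator_const _ hpos, integral_indicator_const _ hneg, Measure.real, Measure.real,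
    h.1, h.2, sub_self]

theorem hasSubgaussianMGF (h : IsRademacher Q σ) (hσ : Measurable σ) :
    HasSubgaussianMGF σ 1 Q := by
  convert hasSubgaussianMGF_of_mem_Icc_of_integral_eq_zero (a := -1) (b := 1) hσ.aemeasurable
    ?_ (h.integral_eq_zero hσ) using 1
  · ext
    norm_num
  · filter_upwards [h.ae_eq_one_or_eq_neg_one hσ] with ω hω
    rcases hω with hω | hω <;> norm_num [hω]

end IsRademacher

theorem hasSubgaussianMGF_of_le {X : Ω → ℝ} {c d : ℝ≥0} (h : HasSubgaussianMGF X c Q)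
    (hcd : c ≤ d) : HasSubgaussianMGF X d Q :=
  ⟨h.integrable_exp_mul, fun t => (h.mgf_le t).trans (by gcongr)⟩

variable [IsProbabilityMeasure Q] [Fintype κ] {σ : κ → Ω → ℝ}

theorem hasSubgaussianMGF_dotProduct_rademacher (hindep : iIndepFun σ Q)
    (hmeas : ∀ i, Measurable (σ i)) (hσ : ∀ i, IsRademacher Q (σ i)) {u : κ → ℝ} {v : ℝ≥0}
    (hv : u ⬝ᵥ u ≤ v) : HasSubgaussianMGF (fun ω => u ⬝ᵥ fun i => σ i ω) v Q := by
  have hindep' : iIndepFun (fun i ω => u i * σ i ω) Q :=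
    hindep.comp (fun i y => u i * y) fun i => measurable_const_mul (u i)
  refine hasSubgaussianMGF_of_le (HasSubgaussianMGF.sum_of_iIndepFun hindep' (s := Finset.univ)
    fun i _ => ((hσ i).hasSubgaussianMGF (hmeas i)).const_mul (u i)) ?_
  rw [← NNReal.coe_le_coe, NNReal.coe_sum]
  refine le_of_eq_of_le (Finset.sum_congr rfl fun i _ => ?_) hv
  exact (mul_one (u i ^ 2)).trans (sq (u i))

theorem measure_le_abs_dotProduct_rademacher_le (hindep : iIndepFun σ Q)
    (hmeas : ∀ i, Measurable (σ i)) (hσ : ∀ i, IsRademacher Q (σ i)) {u : κ → ℝ} {v : ℝ≥0}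
    (hv : u ⬝ᵥ u ≤ v) {t : ℝ} (ht : 0 ≤ t) :
    Q {ω | t ≤ |u ⬝ᵥ fun i => σ i ω|} ≤ ENNReal.ofReal (2 * Real.exp (-t ^ 2 / (2 * v))) := by
  have hX := hasSubgaussianMGF_dotProduct_rademacher hindep hmeas hσ hv
  have hcover : {ω | t ≤ |u ⬝ᵥ fun i => σ i ω|} ⊆
      {ω | t ≤ u ⬝ᵥ fun i => σ i ω} ∪ {ω | t ≤ -(u ⬝ᵥ fun i => σ i ω)} := fun ω hω =>
    le_abs.1 (show t ≤ |u ⬝ᵥ fun i => σ i ω| from hω)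
  rw [← ofReal_measureReal]
  refine ENNReal.ofReal_le_ofReal ?_
  calc _ ≤ _ := measureReal_mono hcover
    _ ≤ _ := measureReal_union_le _ _
    _ ≤ Real.exp (-t ^ 2 / (2 * v)) + Real.exp (-t ^ 2 / (2 * v)) :=
        add_le_add (hX.measure_ge_le ht) (hX.neg.measure_ge_le ht)
    _ = _ := (two_mul _).symm

end Rademacher

section RandomSigns

variable {m N k : ℕ} {Φ : Matrix (Fin m) (Fin N) ℝ} {a : ℝ} {J : Finset (Fin N)}
  {Ω : Type*} [MeasurableSpace Ω] {x : Ω → Fin N → ℝ}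

theorem measurable_sign : Measurable Real.sign :=
  Measurable.ite measurableSet_Iio measurable_const
    (Measurable.ite measurableSet_Ioi measurable_const measurable_const)

/-- The columns of `Φ` indexed by `J` are uniformly linearly independent and the remaining columns
have small correlation with them, `a` bounding the sum of squares. Signals with random signs
supported on such a set `J` are recovered with overwhelming probability. -/
def WellConditioned {m n : Type*} [Fintype m] [Fintype n] (Φ : Matrix m n ℝ) (a : ℝ)
    (J : Finset n) : Prop :=
  (∀ z, (∀ j ∉ J, z j = 0) → 1 / 2 * (z ⬝ᵥ z) ≤ (Φ *ᵥ z) ⬝ᵥ (Φ *ᵥ z)) ∧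
    ∀ j ∉ J, ∑ i ∈ J, (Φ.col j ⬝ᵥ Φ.col i) ^ 2 ≤ a

theorem WellConditioned.bpRecovers (hJ : WellConditioned Φ a J) {y : Fin N → ℝ}
    (hsparse : IsSparse J.card y) (hne : ∀ i ∈ J, y i ≠ 0)
    (hlt : ∀ j ∉ J, |certificateWeights (Φ.submatrix id ((↑) : J → Fin N)) (Φ.col j) ⬝ᵥ
      fun i => Real.sign (y i)| < 1) : BPRecovers Φ y := by
  have hsupp : J = Finset.univ.filter fun i => y i ≠ 0 :=
    Finset.eq_of_subset_of_card_le (fun i hi => by simpa using hne i hi) hsparse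
  refine bpRecovers_of_abs_certificateWeights_lt (by norm_num) hJ.1 (fun j hj => ?_) hlt
  rw [hsupp] at hj
  simpa using hj

theorem WellConditioned.dotProduct_certificateWeights_self_le (hJ : WellConditioned Φ a J)
    {j : Fin N} (hj : j ∉ J) :
    certificateWeights (Φ.submatrix id ((↑) : J → Fin N)) (Φ.col j) ⬝ᵥ
      certificateWeights (Φ.submatrix id ((↑) : J → Fin N)) (Φ.col j) ≤ 4 * a := by
  have h := (sq_mul_dotProduct_certificateWeights_self_le (by norm_num) hJ.1 (Φ.col j)).trans
    (hJ.2 j hj)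
  linarith

theorem WellConditioned.measure_not_bpRecovers_le (hJ : WellConditioned Φ a J) (ha : 0 ≤ a)
    {Q : Measure Ω} [IsProbabilityMeasure Q] (hx : Measurable x)
    (hsparse : ∀ᵐ ω ∂Q, IsSparse J.card (x ω))
    (hindep : iIndepFun (fun (i : J) ω => Real.sign (x ω i)) Q)
    (hsign : ∀ i ∈ J, IsRademacher Q fun ω => Real.sign (x ω i)) :
    Q {ω | ¬ BPRecovers Φ (x ω)} ≤ ENNReal.ofReal (N * (2 * Real.exp (-1 / (8 * a)))) := by
  have hmeas : ∀ i, Measurable fun ω => Real.sign (x ω i) := fun i =>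
    measurable_sign.comp ((measurable_pi_apply i).comp hx)
  have hne : ∀ᵐ ω ∂Q, ∀ i ∈ J, x ω i ≠ 0 := by
    refine (Filter.eventually_all_finset J).2 fun i hi => ?_
    filter_upwards [(hsign i hi).ae_eq_one_or_eq_neg_one (hmeas i)] with ω hω h0
    simp [h0] at hω
  set u : Fin N → J → ℝ := fun j =>
    certificateWeights (Φ.submatrix id ((↑) : J → Fin N)) (Φ.col j)
  have hcover : ∀ᵐ ω ∂Q, ω ∈ {ω | ¬ BPRecovers Φ (x ω)} →
      ω ∈ ⋃ j ∈ Jᶜ, {ω | 1 ≤ |u j ⬝ᵥ fun i => Real.sign (x ω i)|} := by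
    filter_upwards [hne, hsparse] with ω hω hωs hbp
    by_contra! hnot
    simp only [Set.mem_iUnion, Finset.mem_compl, Set.mem_ofPred_eq, not_exists, not_le] at hnot
    exact hbp (hJ.bpRecovers hωs hω hnot)
  have htail : ∀ j ∉ J, Q {ω | 1 ≤ |u j ⬝ᵥ fun i => Real.sign (x ω i)|} ≤
      ENNReal.ofReal (2 * Real.exp (-1 / (8 * a))) := fun j hj => by
    convert measure_le_abs_dotProduct_rademacher_le (v := NNReal.mk (4 * a) (by positivity)) hindep
      (fun i => hmeas i) (fun i => hsign i i.2) (hJ.dotProduct_certificateWeights_self_le hj)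
      zero_le_one using 4
    rw [NNReal.coe_mk]
    ring
  calc Q {ω | ¬ BPRecovers Φ (x ω)} ≤ _ := measure_mono_ae hcover
    _ ≤ ∑ j ∈ Jᶜ, Q {ω | 1 ≤ |u j ⬝ᵥ fun i => Real.sign (x ω i)|} := measure_biUnion_finset_le _ _
    _ ≤ Jᶜ.card • ENNReal.ofReal (2 * Real.exp (-1 / (8 * a))) :=
        Finset.sum_le_card_nsmul _ _ _ fun j hj => htail j (Finset.mem_compl.1 hj)
    _ ≤ N • ENNReal.ofReal (2 * Real.exp (-1 / (8 * a))) := by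
        gcongr
        simpa using Finset.card_le_univ Jᶜ
    _ = _ := by
        rw [nsmul_eq_mul, ENNReal.ofReal_mul (Nat.cast_nonneg N), ENNReal.ofReal_natCast]

theorem ofReal_subsetProb_add {ι : Type*} [Fintype ι] {p : Finset ι → Prop} [DecidablePred p]
    {q : ℝ} (hq : 0 ≤ q) (hk : k ≤ Fintype.card ι) :
    ((Fintype.card ι).choose k : ENNReal)⁻¹ *
        ∑ J ∈ Finset.univ.powersetCard k, ENNReal.ofReal ((if p J then 1 else 0) + q) =
      ENNReal.ofReal (subsetProb k p + q) := by
  have hcard : ((Finset.univ : Finset ι).powersetCard k).card = (Fintype.card ι).choose k := by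
    simp
  have hchoose : (0 : ℝ) < (Fintype.card ι).choose k := by exact_mod_cast Nat.choose_pos hk
  rw [← ENNReal.ofReal_sum_of_nonneg fun J _ => by positivity, ← ENNReal.ofReal_natCast,
    ← ENNReal.ofReal_inv_of_pos hchoose, ← ENNReal.ofReal_mul (by positivity),
    Finset.sum_add_distrib, Finset.sum_const, hcard, nsmul_eq_mul, mul_add,
    inv_mul_cancel_left₀ hchoose.ne', subsetProb, Finset.expect_eq_sum_div_card, hcard,
    inv_mul_eq_div]
  congr!

open Classical in
theorem measure_inter_not_bpRecovers_le (ha : 0 ≤ a) {P : Measure Ω} (hx : Measurable x)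
    (hsparse : ∀ᵐ ω ∂P, IsSparse J.card (x ω)) {S : Set Ω} (hS : MeasurableSet S) (hS0 : P S ≠ 0)
    (hStop : P S ≠ ⊤)
    (hindep : iIndepFun (fun (i : J) ω => Real.sign (x ω i)) (cond P S))
    (hsign : ∀ i ∈ J, IsRademacher (cond P S) fun ω => Real.sign (x ω i)) :
    P (S ∩ {ω | ¬ BPRecovers Φ (x ω)}) ≤ P S * ENNReal.ofReal
      ((if ¬ WellConditioned Φ a J then 1 else 0) + N * (2 * Real.exp (-1 / (8 * a)))) := by
  by_cases hJ : WellConditioned Φ a J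
  · have := cond_isProbabilityMeasure_of_finite hS0 hStop
    rw [if_neg (not_not.2 hJ), zero_add, ← cond_mul_eq_inter' hS hStop, mul_comm]
    gcongr
    exact hJ.measure_not_bpRecovers_le ha hx (cond_absolutelyContinuous.ae_le hsparse) hindep hsign
  · rw [if_pos hJ]
    refine (measure_mono Set.inter_subset_left).trans (le_mul_of_one_le_right' ?_)
    rw [← ENNReal.ofReal_one]
    exact ENNReal.ofReal_le_ofReal (le_add_of_nonneg_right (by positivity))

open Classical in
theorem IsGenericRandomSignal.measure_not_bpRecovers_le {P : Measure Ω}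
    (hx : IsGenericRandomSignal P k x) (hk : k ≤ N) (hsparse : ∀ᵐ ω ∂P, IsSparse k (x ω))
    (ha : 0 ≤ a) :
    P {ω | ¬ BPRecovers Φ (x ω)} ≤ ENNReal.ofReal
      (subsetProb k (fun J => ¬ WellConditioned Φ a J) + N * (2 * Real.exp (-1 / (8 * a)))) := by
  obtain ⟨hxm, I, hIm, hIae, hI⟩ := hx
  set q : ℝ := N * (2 * Real.exp (-1 / (8 * a)))
  set 𝒰 := (Finset.univ : Finset (Fin N)).powersetCard k
  have hchoose : (N.choose k : ENNReal) ≠ 0 := by exact_mod_cast (Nat.choose_pos hk).ne'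
  have hcover : P {ω | ¬ BPRecovers Φ (x ω)} ≤
      P (⋃ J ∈ 𝒰, {ω | I ω = J} ∩ {ω | ¬ BPRecovers Φ (x ω)}) := by
    refine measure_mono_ae ?_
    filter_upwards [hIae] with ω hω hbp
    exact Set.mem_biUnion (x := I ω) (Finset.mem_powersetCard_univ.2 hω.1) ⟨rfl, hbp⟩
  have hterm : ∀ J ∈ 𝒰, P ({ω | I ω = J} ∩ {ω | ¬ BPRecovers Φ (x ω)}) ≤
      (N.choose k : ENNReal)⁻¹ *
        ENNReal.ofReal ((if ¬ WellConditioned Φ a J then 1 else 0) + q) := fun J hJ => by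
    have hJk := Finset.mem_powersetCard_univ.1 hJ
    obtain ⟨hPJ, hindep, hsign⟩ := hI J hJk
    rw [← hPJ]
    exact measure_inter_not_bpRecovers_le ha hxm (hJk ▸ hsparse) (hIm J)
      (hPJ ▸ ENNReal.inv_ne_zero.2 (ENNReal.natCast_ne_top _))
      (hPJ ▸ ENNReal.inv_ne_top.2 hchoose) hindep hsign
  calc P {ω | ¬ BPRecovers Φ (x ω)}
      ≤ ∑ J ∈ 𝒰, P ({ω | I ω = J} ∩ {ω | ¬ BPRecovers Φ (x ω)}) :=
        hcover.trans (measure_biUnion_finset_le _ _)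
    _ ≤ (N.choose k : ENNReal)⁻¹ *
        ∑ J ∈ 𝒰, ENNReal.ofReal ((if ¬ WellConditioned Φ a J then 1 else 0) + q) := by
        rw [Finset.mul_sum]
        exact Finset.sum_le_sum hterm
    _ = ENNReal.ofReal (subsetProb k (fun J => ¬ WellConditioned Φ a J) + q) := by
        rw [← ofReal_subsetProb_add (by positivity) (by simpa using hk), Fintype.card_fin]

end RandomSigns

section Hollow

variable {n : Type*} [DecidableEq n] {A : Matrix n n ℝ}

/-- `A` with its diagonal replaced by zero. -/
def hollow (A : Matrix n n ℝ) : Matrix n n ℝ :=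
  A - diagonal A.diag

@[simp]
theorem hollow_apply_self (A : Matrix n n ℝ) (i : n) : hollow A i i = 0 := by
  simp [hollow]

theorem hollow_apply_of_ne (A : Matrix n n ℝ) {i j : n} (hij : i ≠ j) : hollow A i j = A i j := by
  simp [hollow, hij]

theorem isSymm_hollow (hA : A.IsSymm) : (hollow A).IsSymm :=
  hA.sub (isSymm_diagonal _)

variable [Fintype n]

theorem sum_hollow_sq_le (A : Matrix n n ℝ) (i : n) :
    ∑ j, hollow A i j ^ 2 ≤ ∑ j, A i j ^ 2 := by
  refine Finset.sum_le_sum fun j _ => ?_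
  rcases eq_or_ne i j with rfl | hij
  · simpa using sq_nonneg (A i i)
  · rw [hollow_apply_of_ne A hij]

theorem hollow_mulVec (A : Matrix n n ℝ) (z : n → ℝ) :
    hollow A *ᵥ z = A *ᵥ z - A.diag * z := by
  ext i
  simp [hollow, sub_mulVec, mulVec_diagonal]

theorem dotProduct_hollow_mulVec_self_le {c : ℝ}
    (hA : ∀ z, (A *ᵥ z) ⬝ᵥ (A *ᵥ z) ≤ c * (z ⬝ᵥ z)) (hdiag : ∀ i, A i i ^ 2 ≤ c) (z : n → ℝ) :
    (hollow A *ᵥ z) ⬝ᵥ (hollow A *ᵥ z) ≤ 4 * c * (z ⬝ᵥ z) := by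
  have hD : (A.diag * z) ⬝ᵥ (A.diag * z) ≤ c * (z ⬝ᵥ z) := by
    simp only [dotProduct, Finset.mul_sum, Pi.mul_apply, diag_apply]
    refine Finset.sum_le_sum fun i _ => ?_
    rw [mul_mul_mul_comm, ← sq]
    exact mul_le_mul_of_nonneg_right (hdiag i) (mul_self_nonneg _)
  have hparallelogram : (A *ᵥ z - A.diag * z) ⬝ᵥ (A *ᵥ z - A.diag * z) ≤
      2 * ((A *ᵥ z) ⬝ᵥ (A *ᵥ z)) + 2 * ((A.diag * z) ⬝ᵥ (A.diag * z)) := by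
    simp only [dotProduct, Finset.mul_sum, ← Finset.sum_add_distrib]
    refine Finset.sum_le_sum fun i _ => ?_
    simp only [Pi.sub_apply]
    nlinarith [sq_nonneg ((A *ᵥ z) i + (A.diag * z) i)]
  rw [hollow_mulVec]
  linarith [hA z]

end Hollow

section TruncatedGram

variable {n : Type*} [Fintype n] [DecidableEq n] {G : Matrix n n ℝ} {κ ρ : ℝ}

theorem sum_apply_sq_eq_sq_apply_self (hG : G.IsSymm) (i : n) :
    ∑ j, G i j ^ 2 = (G ^ 2) i i := by
  rw [sq, mul_apply]
  exact Finset.sum_congr rfl fun j _ => by rw [sq, hG.apply i j]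

omit [Fintype n] [DecidableEq n] in
theorem isSymm_of_posSemidef (hG : G.PosSemidef) : G.IsSymm := by
  simpa [IsSymm] using hG.1

theorem spectralTruncation_apply_self_le (hG : G.PosSemidef) (i : n) :
    spectralTruncation G κ i i ≤ G i i := by
  simpa using (le_iff.1 (spectralTruncation_le hG.1)).diag_nonneg (i := i)

theorem sub_spectralTruncation_apply_self_le (hG : G.PosSemidef) (hκ : 0 < κ) {i : n}
    (hρ : ∑ j, G i j ^ 2 ≤ ρ) : (G - spectralTruncation G κ) i i ≤ ρ / κ := by
  have h := (le_iff.1 (sub_spectralTruncation_le hG hκ)).diag_nonneg (i := i)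
  rw [Matrix.sub_apply, Matrix.smul_apply, smul_eq_mul, sub_nonneg,
    ← sum_apply_sq_eq_sq_apply_self (isSymm_of_posSemidef hG)] at h
  rw [div_eq_inv_mul]
  exact h.trans (mul_le_mul_of_nonneg_left hρ (inv_nonneg.2 hκ.le))

theorem sum_spectralTruncation_sq_le (hG : G.PosSemidef) (hκ : 0 ≤ κ) (i : n) :
    ∑ j, spectralTruncation G κ i j ^ 2 ≤ ∑ j, G i j ^ 2 := by
  rw [sum_apply_sq_eq_sq_apply_self (isSymm_of_posSemidef hG),
    sum_apply_sq_eq_sq_apply_self (isSymm_of_posSemidef (spectralTruncation_posSemidef hG hκ))]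
  simpa using (le_iff.1 (spectralTruncation_sq_le hG hκ)).diag_nonneg (i := i)

theorem abs_hollow_spectralTruncation_apply_le (hG : G.PosSemidef) (hκ : 0 < κ)
    (hρ : ∀ i, ∑ j, G i j ^ 2 ≤ ρ) (i j : n) :
    |hollow (spectralTruncation G κ) i j| ≤ |hollow G i j| + ρ / κ := by
  rcases eq_or_ne i j with rfl | hij
  · have hρ0 : 0 ≤ ρ := (Finset.sum_nonneg fun _ _ => sq_nonneg _).trans (hρ i)
    simpa using div_nonneg hρ0 hκ.le
  · have hloss : |(G - spectralTruncation G κ) i j| ≤ ρ / κ :=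
      abs_apply_le_of_posSemidef (le_iff.1 (spectralTruncation_le hG.1))
        (fun i => sub_spectralTruncation_apply_self_le hG hκ (hρ i)) i j
    rw [hollow_apply_of_ne _ hij, hollow_apply_of_ne _ hij]
    calc |spectralTruncation G κ i j| = |G i j - (G - spectralTruncation G κ) i j| := by simp
      _ ≤ |G i j| + |(G - spectralTruncation G κ) i j| := abs_sub _ _
      _ ≤ _ := by gcongr

theorem hollow_spectralTruncation_apply_sq_le {γ η : ℝ} (hG : G.PosSemidef)
    (hκ : 0 < κ) (hρ : ∀ i, ∑ j, G i j ^ 2 ≤ ρ) (hγ : ∀ i j, hollow G i j ^ 2 ≤ γ)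
    (hη : ρ / κ ≤ η) (i j : n) :
    hollow (spectralTruncation G κ) i j ^ 2 ≤ 2 * γ + 2 * η ^ 2 := by
  have hle := (abs_hollow_spectralTruncation_apply_le hG hκ hρ i j).trans (add_le_add_right hη _)
  calc _ = |hollow (spectralTruncation G κ) i j| ^ 2 := (sq_abs _).symm
    _ ≤ (|hollow G i j| + η) ^ 2 := pow_le_pow_left₀ (abs_nonneg _) hle 2
    _ ≤ 2 * (|hollow G i j| ^ 2 + η ^ 2) := add_sq_le
    _ ≤ 2 * γ + 2 * η ^ 2 := by rw [sq_abs]; linarith [hγ i j]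

theorem add_dotProduct_hollow_spectralTruncation_le (hG : G.PosSemidef) (hdiag : ∀ i, G i i = 1)
    (hκ : 0 < κ) (hρ : ∀ i, ∑ j, G i j ^ 2 ≤ ρ) {η : ℝ} (hη : ρ / κ ≤ η) (z : n → ℝ) :
    (1 - η) * (z ⬝ᵥ z) + z ⬝ᵥ hollow (spectralTruncation G κ) *ᵥ z ≤ z ⬝ᵥ G *ᵥ z := by
  have hle : z ⬝ᵥ spectralTruncation G κ *ᵥ z ≤ z ⬝ᵥ G *ᵥ z := by
    have h := (le_iff.1 (spectralTruncation_le (κ := κ) hG.1)).dotProduct_mulVec_nonneg z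
    rwa [star_trivial, sub_mulVec, dotProduct_sub, sub_nonneg] at h
  have hdiagonal : (1 - η) * (z ⬝ᵥ z) ≤ z ⬝ᵥ ((spectralTruncation G κ).diag * z) := by
    simp only [dotProduct, Finset.mul_sum, Pi.mul_apply, diag_apply]
    refine Finset.sum_le_sum fun i _ => ?_
    have h := (sub_spectralTruncation_apply_self_le hG hκ (hρ i)).trans hη
    rw [Matrix.sub_apply, hdiag] at h
    nlinarith [mul_self_nonneg (z i)]
  rw [hollow_mulVec, dotProduct_sub]
  linarith

theorem dotProduct_hollow_spectralTruncation_mulVec_self_le (hG : G.PosSemidef) (hκ : 0 ≤ κ)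
    (hdiag : ∀ i, G i i ≤ κ) (z : n → ℝ) :
    (hollow (spectralTruncation G κ) *ᵥ z) ⬝ᵥ (hollow (spectralTruncation G κ) *ᵥ z) ≤
      4 * κ ^ 2 * (z ⬝ᵥ z) := by
  have hB := spectralTruncation_posSemidef hG hκ
  refine dotProduct_hollow_mulVec_self_le (fun w => ?_) (fun i => ?_) z
  · have h := dotProduct_spectralTruncation_sq_le hG hκ w
    rwa [sq, ← mulVec_mulVec, dotProduct_mulVec, ← mulVec_transpose,
      (isSymm_of_posSemidef hB).eq] at h
  · exact pow_le_pow_left₀ hB.diag_nonneg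
      ((spectralTruncation_apply_self_le hG i).trans (hdiag i)) 2

end TruncatedGram

section SamplingGramMatrix

variable {m n : Type*} [Fintype m] [Fintype n] {Φ : Matrix m n ℝ} {k P : ℕ}

omit [Fintype n] in
theorem gram_posSemidef [Finite n] (Φ : Matrix m n ℝ) : (Φᵀ * Φ).PosSemidef := by
  simpa using posSemidef_conjTranspose_mul_self Φ

theorem dotProduct_gram_mulVec (Φ : Matrix m n ℝ) (z : n → ℝ) :
    z ⬝ᵥ (Φᵀ * Φ) *ᵥ z = (Φ *ᵥ z) ⬝ᵥ (Φ *ᵥ z) := by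
  rw [← mulVec_mulVec, dotProduct_mulVec, vecMul_transpose]

theorem subsetProb_exists_lt_sum_apply_eq_zero {Z : Matrix n n ℝ} {r a : ℝ}
    (hZ : ∀ i j, Z i j ^ 2 ≤ r) (hkr : k * r ≤ a) :
    subsetProb k (fun I => ∃ i, a < ∑ j ∈ I, Z i j ^ 2) = 0 := by
  classical
  refine Finset.expect_eq_zero fun I hI => if_neg ?_
  rintro ⟨i, hi⟩
  refine hi.not_ge (le_trans ?_ hkr)
  simpa [(Finset.mem_powersetCard.1 hI).2] using Finset.sum_le_card_nsmul I _ r fun j _ => hZ i j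

variable [DecidableEq n]

theorem subsetProb_not_wellConditioned_le {Y : Matrix n n ℝ} {a b δ : ℝ}
    (hlow : ∀ z, 3 / 4 * (z ⬝ᵥ z) + z ⬝ᵥ Y *ᵥ z ≤ (Φ *ᵥ z) ⬝ᵥ (Φ *ᵥ z))
    (hgramRow : subsetProb k (fun I => ∃ i, a < ∑ j ∈ I, hollow (Φᵀ * Φ) i j ^ 2) ≤ δ)
    (hrow : subsetProb k (fun I => ∃ i, a < ∑ j ∈ I, Y i j ^ 2) ≤ δ)
    (hcol : subsetProb k (fun I => ∃ z, (∀ j ∉ I, z j = 0) ∧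
      b * (z ⬝ᵥ z) < (Y *ᵥ z) ⬝ᵥ (Y *ᵥ z)) ≤ δ)
    (hform : subsetProb k (fun I => Regular Y a b I ∧ ∃ z, (∀ j ∉ I, z j = 0) ∧
      1 / 4 * (z ⬝ᵥ z) < |z ⬝ᵥ Y *ᵥ z|) ≤ δ) :
    subsetProb k (fun I => ¬ WellConditioned Φ a I) ≤ 4 * δ := by
  have hcover : ∀ I : Finset n, I.card = k → ¬ WellConditioned Φ a I →
      (((∃ i, a < ∑ j ∈ I, hollow (Φᵀ * Φ) i j ^ 2) ∨ ∃ i, a < ∑ j ∈ I, Y i j ^ 2) ∨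
        ∃ z, (∀ j ∉ I, z j = 0) ∧ b * (z ⬝ᵥ z) < (Y *ᵥ z) ⬝ᵥ (Y *ᵥ z)) ∨
      (Regular Y a b I ∧ ∃ z, (∀ j ∉ I, z j = 0) ∧ 1 / 4 * (z ⬝ᵥ z) < |z ⬝ᵥ Y *ᵥ z|) := by
    intro I _
    contrapose!
    rintro ⟨⟨⟨hgramRow, hrow⟩, hcol⟩, hform⟩
    refine ⟨fun z hz => ?_, fun j hj => (hgramRow j).trans' (le_of_eq ?_)⟩
    · linarith [hlow z, hform ⟨hrow, hcol⟩ z hz, neg_abs_le (z ⬝ᵥ Y *ᵥ z)]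
    · exact Finset.sum_congr rfl fun i hi => by
        rw [hollow_apply_of_ne _ (ne_of_mem_of_not_mem hi hj).symm]; rfl
  calc _ ≤ _ := subsetProb_mono hcover
    _ ≤ _ := subsetProb_or_le
    _ ≤ _ := add_le_add_left (subsetProb_or_le.trans (add_le_add_left subsetProb_or_le _)) _
    _ ≤ δ + δ + δ + δ := by gcongr
    _ = 4 * δ := by ring

end SamplingGramMatrix

section Parameters

variable {m n : Type*} [Fintype m] [Fintype n] [DecidableEq n] {Φ : Matrix m n ℝ} {k P : ℕ}
  {ρ L : ℝ}

theorem mul_exp_le_div_exp_one {t x y c : ℝ} (hc : 0 ≤ c) (hx : 0 ≤ x) (ht : 0 < t)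
    (hxy : 3 * x ≤ y * t) (hcy : 3 * (c * Real.exp y) ≤ t) :
    c * Real.exp (x / (t / Real.exp 1)) ≤ t / Real.exp 1 := by
  have hexponent : x / (t / Real.exp 1) ≤ y := by
    rw [div_div_eq_mul_div, div_le_iff₀ ht]
    nlinarith [Real.exp_one_lt_three]
  rw [le_div_iff₀ (Real.exp_pos 1)]
  calc c * Real.exp (x / (t / Real.exp 1)) * Real.exp 1 ≤ c * Real.exp y * 3 := by
        gcongr
        exact Real.exp_one_lt_three.le
    _ ≤ t := by linarith

omit [DecidableEq n] in
theorem subsetProb_exists_long_row_le {Z : Matrix n n ℝ} {r D : ℝ} (hL : 1 ≤ L)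
    (hPL : P ≤ 3 * L) (hk : 2 * k ≤ Fintype.card n) (hr : 0 ≤ r) (hρ : 0 ≤ ρ)
    (hZr : ∀ i j, Z i j ^ 2 ≤ r) (hZρ : ∀ i, ∑ j, Z i j ^ 2 ≤ ρ)
    (hsize : 100000 * Real.exp D * L ^ 2 * (ρ * k) ≤ Fintype.card n)
    (hentry : k * r ≤ 1 / (5000 * L) ∨ 45000 * L ^ 2 * r ≤ D) :
    subsetProb k (fun I => ∃ i, 1 / (5000 * L) < ∑ j ∈ I, Z i j ^ 2) ≤
      Fintype.card n * Real.exp (-P) := by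
  rcases hentry with hkr | hD
  · rw [subsetProb_exists_lt_sum_apply_eq_zero hZr hkr]
    positivity
  · refine subsetProb_exists_lt_sum_apply_sq_le hr hZr hρ hZρ (by positivity) hk
      (mul_exp_le_div_exp_one (y := D) (by positivity) (by positivity) (by positivity) ?_ ?_)
    · rw [mul_one_div, le_div_iff₀ (by positivity)]
      calc 3 * (P * r) * (5000 * L) ≤ 3 * (3 * L * r) * (5000 * L) := by gcongr
        _ = 45000 * L ^ 2 * r := by ring
        _ ≤ D := hD
    · rw [div_mul_eq_mul_div, mul_div_assoc', le_div_iff₀ (by positivity), div_mul_eq_mul_div]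
      refine div_le_one_of_le₀ (le_trans ?_ hsize) (Nat.cast_nonneg _)
      calc 3 * (2 * ρ * k * Real.exp D) * (5000 * L) = 30000 * Real.exp D * L * (ρ * k) := by ring
        _ ≤ 100000 * Real.exp D * L ^ 2 * (ρ * k) := by
          gcongr
          · norm_num
          · exact le_self_pow₀ hL two_ne_zero

omit [DecidableEq n] in
theorem subsetProb_exists_large_column_le {Y : Matrix n n ℝ} {κ : ℝ} (hL : 1 ≤ L)
    (hPL : P ≤ 3 * L) (hk0 : 0 < k) (hk : 2 * k ≤ Fintype.card n) (hρ : 0 ≤ ρ)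
    (hY : Y.IsSymm) (hYρ : ∀ i, ∑ j, Y i j ^ 2 ≤ ρ)
    (hκ : κ = Fintype.card n / (1000 * k))
    (hYκ : ∀ z, (Y *ᵥ z) ⬝ᵥ (Y *ᵥ z) ≤ 4 * κ ^ 2 * (z ⬝ᵥ z))
    (hsize : 100000 * L ^ 2 * (ρ * k) ≤ Fintype.card n) :
    subsetProb k (fun I => ∃ z, (∀ j ∉ I, z j = 0) ∧
      Fintype.card n / (6000 * k) * (z ⬝ᵥ z) < (Y *ᵥ z) ⬝ᵥ (Y *ᵥ z)) ≤
      Fintype.card n * Real.exp (-P) := by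
  have hN : (0 : ℝ) < Fintype.card n := by exact_mod_cast (by omega : 0 < Fintype.card n)
  refine subsetProb_exists_lt_mulVec_le hY hρ hYρ (by positivity) hYκ (by positivity) hk
    (mul_exp_le_div_exp_one (y := 1) (by positivity) (by positivity) (by positivity) ?_ ?_)
  · rw [one_mul, le_div_iff₀ (by positivity)]
    refine le_trans ?_ hsize
    calc 3 * (P * ρ) * (6000 * k) ≤ 3 * (3 * L * ρ) * (6000 * k) := by gcongr
      _ = 54000 * L * (ρ * k) := by ring
      _ ≤ 100000 * L ^ 2 * (ρ * k) := by
        gcongr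
        · norm_num
        · exact le_self_pow₀ hL two_ne_zero
  · calc 3 * (2 * (4 * κ ^ 2) * k / Fintype.card n * Real.exp 1)
        = Fintype.card n / (6000 * k) * (144 / 1000 * Real.exp 1) := by
          rw [hκ]
          field_simp
          norm_num
      _ ≤ Fintype.card n / (6000 * k) :=
        mul_le_of_le_one_right (by positivity) (by linarith [Real.exp_one_lt_three])

omit [DecidableEq n] in
theorem subsetProb_regular_and_large_form_le {Y : Matrix n n ℝ} (hL : 1 ≤ L)
    (hPL : P ≤ 3 * L) (hk0 : 0 < k) (hk : 2 * k ≤ Fintype.card n) (hY : ∀ i, Y i i = 0) :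
    subsetProb k (fun I => Regular Y (1 / (5000 * L)) (Fintype.card n / (6000 * k)) I ∧
      ∃ z, (∀ j ∉ I, z j = 0) ∧ 1 / 4 * (z ⬝ᵥ z) < |z ⬝ᵥ Y *ᵥ z|) ≤
      Fintype.card n * Real.exp (-P) := by
  have hN : (0 : ℝ) < Fintype.card n := by exact_mod_cast (by omega : 0 < Fintype.card n)
  refine subsetProb_regular_and_exists_lt_le hY (by positivity) (by positivity) (by norm_num) hk
    (mul_exp_le_div_exp_one (y := 1) (by positivity) (by positivity) (by norm_num) ?_ ?_)
  · rw [mul_one_div, mul_div_assoc', div_le_iff₀ (by positivity)]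
    linarith
  · have hcoeff : 2 * (Fintype.card n / (6000 * k)) * k / Fintype.card n = (1 / 3000 : ℝ) := by
      field_simp
      norm_num
    rw [hcoeff]
    linarith [Real.exp_one_lt_three]

theorem div_le_one_div_of_mul_le {N : ℝ} (hL : 0 < L) (hN : 0 < N)
    (hsize : 100000 * L ^ 2 * (ρ * k) ≤ N) : ρ / (N / (1000 * k)) ≤ 1 / (100 * L ^ 2) := by
  rw [div_div_eq_mul_div, div_le_div_iff₀ (by positivity) (by positivity)]
  linarith

theorem subsetProb_not_wellConditioned_le_exp {γ D : ℝ} (hL : 1 ≤ L) (hPL : P ≤ 3 * L)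
    (hk : 0 < k) (hkn : 1000 * k ≤ Fintype.card n) (hD : 0 ≤ D) (hdiag : ∀ i, (Φᵀ * Φ) i i = 1)
    (hγ : ∀ i j, hollow (Φᵀ * Φ) i j ^ 2 ≤ γ) (hρ : ∀ i, ∑ j, (Φᵀ * Φ) i j ^ 2 ≤ ρ)
    (hsize : 100000 * Real.exp D * L ^ 2 * (ρ * k) ≤ Fintype.card n)
    (hentry : k * (2 * γ + 1 / (5000 * L ^ 4)) ≤ 1 / (5000 * L) ∨
      45000 * L ^ 2 * (2 * γ + 1 / (5000 * L ^ 4)) ≤ D) :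
    subsetProb k (fun I => ¬ WellConditioned Φ (1 / (5000 * L)) I) ≤
      4 * (Fintype.card n * Real.exp (-P)) := by
  have hcard : 0 < Fintype.card n := by omega
  obtain ⟨i₀⟩ := Fintype.card_pos_iff.1 hcard
  have hγ0 : 0 ≤ γ := (sq_nonneg _).trans (hγ i₀ i₀)
  have hρ0 : 0 ≤ ρ := (Finset.sum_nonneg fun j _ => sq_nonneg _).trans (hρ i₀)
  have hsize' : 100000 * L ^ 2 * (ρ * k) ≤ Fintype.card n := by
    refine le_trans ?_ hsize
    gcongr
    exact le_mul_of_one_le_right (by norm_num) (Real.one_le_exp hD)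
  -- At this height the truncation costs at most `ρ / κ` on the diagonal, while the mean of
  -- `∑ i ∈ I, (Y i ⬝ᵥ z) ^ 2` over random `I` is at most `4 κ² k / N = N / (250000 k)` times
  -- `z ⬝ᵥ z`.
  set κ : ℝ := Fintype.card n / (1000 * k) with hκ
  have hκ1 : 1 ≤ κ := by
    rw [hκ, one_le_div (by positivity)]
    exact_mod_cast hkn
  have hκ0 : 0 < κ := by linarith
  have hloss : ρ / κ ≤ 1 / (100 * L ^ 2) :=
    div_le_one_div_of_mul_le (by linarith) (by exact_mod_cast hcard) hsize'
  have hG := gram_posSemidef Φ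
  set Y := hollow (spectralTruncation (Φᵀ * Φ) κ)
  have hYrow : ∀ i, ∑ j, Y i j ^ 2 ≤ ρ := fun i =>
    (sum_hollow_sq_le _ i).trans ((sum_spectralTruncation_sq_le hG hκ0.le i).trans (hρ i))
  have hYentry : ∀ i j, Y i j ^ 2 ≤ 2 * γ + 1 / (5000 * L ^ 4) := fun i j =>
    (hollow_spectralTruncation_apply_sq_le hG hκ0 hρ hγ hloss i j).trans_eq (by ring)
  have hgramEntry : ∀ i j, hollow (Φᵀ * Φ) i j ^ 2 ≤ 2 * γ + 1 / (5000 * L ^ 4) := fun i j =>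
    (hγ i j).trans (by linarith [show 0 ≤ 1 / (5000 * L ^ 4) by positivity])
  have hlow : ∀ z, 3 / 4 * (z ⬝ᵥ z) + z ⬝ᵥ Y *ᵥ z ≤ (Φ *ᵥ z) ⬝ᵥ (Φ *ᵥ z) := fun z => by
    have h := add_dotProduct_hollow_spectralTruncation_le hG hdiag hκ0 hρ (η := 1 / 4)
      (hloss.trans (one_div_le_one_div_of_le (by norm_num) (by nlinarith))) z
    rwa [dotProduct_gram_mulVec, show (1 - 1 / 4 : ℝ) = 3 / 4 by norm_num] at h
  exact subsetProb_not_wellConditioned_le hlow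
    (subsetProb_exists_long_row_le hL hPL (by omega) (by positivity) hρ0 hgramEntry
      (fun i => (sum_hollow_sq_le _ i).trans (hρ i)) hsize hentry)
    (subsetProb_exists_long_row_le hL hPL (by omega) (by positivity) hρ0 hYentry hYrow
      hsize hentry)
    (subsetProb_exists_large_column_le hL hPL hk (by omega) hρ0
      (isSymm_hollow (isSymm_of_posSemidef (spectralTruncation_posSemidef hG hκ0.le))) hYrow hκ
      (dotProduct_hollow_spectralTruncation_mulVec_self_le hG hκ0.le fun i =>
        (hdiag i).trans_le hκ1) hsize')
    (subsetProb_regular_and_large_form_le hL hPL hk (by omega) (hollow_apply_self _))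

theorem sq_mul_le_of_le {q γ u v : ℝ} (hq : 0 ≤ q) (hu : 0 < u) (hv : 1 ≤ v)
    (hγ : γ ≤ q / (u * v ^ 3)) (huv : 20000 * (q + 1) * u ≤ v) :
    u ^ 2 * (2 * γ + 1 / (5000 * v ^ 8)) ≤ 1 / (5000 * v ^ 2) := by
  have hcoherence : u ^ 2 * γ ≤ 1 / (20000 * v ^ 2) := by
    refine (mul_le_mul_of_nonneg_left hγ (by positivity)).trans ?_
    rw [mul_div_assoc', div_le_div_iff₀ (by positivity) (by positivity)]
    calc u ^ 2 * q * (20000 * v ^ 2) = 20000 * q * u * (u * v ^ 2) := by ring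
      _ ≤ v * (u * v ^ 2) := by gcongr; nlinarith
      _ = 1 * (u * v ^ 3) := by ring
  have htruncation : u ^ 2 / (5000 * v ^ 8) ≤ 1 / (10000 * v ^ 2) := by
    rw [div_le_div_iff₀ (by positivity) (by positivity)]
    have hpow : 2 * u ^ 2 ≤ v ^ 6 := by
      have h2 : 2 * u ≤ v := by nlinarith [mul_nonneg hq hu.le]
      calc 2 * u ^ 2 ≤ (2 * u) ^ 2 := by nlinarith
        _ ≤ v ^ 2 := by gcongr
        _ ≤ v ^ 6 := pow_le_pow_right₀ hv (by norm_num)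
    calc u ^ 2 * (10000 * v ^ 2) = 2 * u ^ 2 * (5000 * v ^ 2) := by ring
      _ ≤ v ^ 6 * (5000 * v ^ 2) := by gcongr
      _ = 1 * (5000 * v ^ 8) := by ring
  calc u ^ 2 * (2 * γ + 1 / (5000 * v ^ 8)) = 2 * (u ^ 2 * γ) + u ^ 2 / (5000 * v ^ 8) := by ring
    _ ≤ 2 * (1 / (20000 * v ^ 2)) + 1 / (10000 * v ^ 2) := by gcongr
    _ = 1 / (5000 * v ^ 2) := by field_simp; norm_num

theorem pow_four_mul_le_of_le {q γ u v : ℝ} (hq : 0 ≤ q) (hu : 0 < u) (hv : 1 ≤ v)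
    (hγ : γ ≤ q / (u * v ^ 3)) (hvu : v ≤ 20000 * (q + 1) * u) :
    v ^ 4 * (2 * γ + 1 / (5000 * v ^ 8)) ≤ 40000 * q * (q + 1) + 1 := by
  have hv0 : 0 < v := by linarith
  have hcoherence : v ^ 4 * γ ≤ 20000 * q * (q + 1) := by
    refine (mul_le_mul_of_nonneg_left hγ (by positivity)).trans ?_
    rw [mul_div_assoc', div_le_iff₀ (by positivity)]
    calc v ^ 4 * q = q * v ^ 3 * v := by ring
      _ ≤ q * v ^ 3 * (20000 * (q + 1) * u) := by gcongr
      _ = 20000 * q * (q + 1) * (u * v ^ 3) := by ring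
  have htruncation : v ^ 4 * (1 / (5000 * v ^ 8)) ≤ 1 := by
    rw [mul_one_div, div_le_one (by positivity)]
    nlinarith [pow_le_pow_right₀ hv (by norm_num : 4 ≤ 8), pow_pos hv0 8]
  linarith

/-- If `k` is small compared with `L`, then `k` entries make a short row whatever their positions;
otherwise `L` is small compared with `k`, so that the single entries are of order `L⁻²`. -/
theorem mul_entry_le_or_sq_mul_entry_le {q γ k L : ℝ} (hq : 0 ≤ q) (hk : 1 ≤ k) (hL : 1 ≤ L)
    (hγ : γ ≤ q / (√k * √L ^ 3)) :
    k * (2 * γ + 1 / (5000 * L ^ 4)) ≤ 1 / (5000 * L) ∨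
      45000 * L ^ 2 * (2 * γ + 1 / (5000 * L ^ 4)) ≤ 45000 * (40000 * q * (q + 1) + 1) := by
  have hk0 : 0 < √k := Real.sqrt_pos.2 (by linarith)
  have hsq : √L ^ 2 = L := Real.sq_sqrt (by linarith)
  refine (le_total (20000 * (q + 1) * √k) √L).imp (fun h => ?_) fun h => ?_
  · have hsmall := sq_mul_le_of_le hq hk0 (Real.one_le_sqrt.2 hL) hγ h
    rwa [pow_mul √L 2 4, hsq, Real.sq_sqrt (by linarith)] at hsmall
  · have hbdd := pow_four_mul_le_of_le hq hk0 (Real.one_le_sqrt.2 hL) hγ h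
    rw [pow_mul √L 2 4, pow_mul √L 2 2, hsq] at hbdd
    linarith

theorem div_sqrt_le_of_mul_le {s c k L M : ℝ} (hs : 0 ≤ s) (hc : 0 < c) (hk : 0 < k) (hL : 0 < L)
    (hM : c * (k * L ^ 3) ≤ M) : s / √M ≤ s / √c / (√k * √L ^ 3) := by
  rw [div_div]
  gcongr
  refine Real.le_sqrt_of_sq_le (le_of_eq_of_le ?_ hM)
  rw [mul_pow, mul_pow, Real.sq_sqrt hc.le, Real.sq_sqrt hk.le, pow_right_comm,
    Real.sq_sqrt hL.le]

end Parameters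

section Asymptotics

variable {m N k : ℕ} {Φ : Matrix (Fin m) (Fin N) ℝ}

theorem gram_apply_self (h : UnitNormColumns Φ) (j : Fin N) : (Φᵀ * Φ) j j = 1 := by
  have hnorm : ‖WithLp.toLp 2 (Φ.col j)‖ ^ 2 = 1 := by rw [h j, one_pow]
  rw [EuclideanSpace.real_norm_sq_eq] at hnorm
  rw [← hnorm, mul_apply]
  exact Finset.sum_congr rfl fun a _ => (sq _).symm

theorem hollow_gram_sq_le {C₁ : ℝ} (h : mutualCoherence Φ ≤ C₁ * (m : ℝ) ^ (-(1 / 4) : ℝ))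
    (i j : Fin N) : hollow (Φᵀ * Φ) i j ^ 2 ≤ C₁ ^ 2 / √m := by
  rcases eq_or_ne i j with rfl | hij
  · rw [hollow_apply_self, sq, mul_zero]
    positivity
  have hcoherence : |(Φᵀ * Φ) i j| ≤ C₁ * (m : ℝ) ^ (-(1 / 4) : ℝ) :=
    (le_ciSup (f := fun p : {p : Fin N × Fin N // p.1 ≠ p.2} => pairCoherence Φ p.1.1 p.1.2)
      (Set.finite_range _).bddAbove ⟨(i, j), hij⟩).trans h
  have hroot : ((m : ℝ) ^ (-(1 / 4) : ℝ)) ^ 2 = (√m)⁻¹ := by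
    rw [← Real.rpow_natCast, ← Real.rpow_mul (Nat.cast_nonneg m), Real.sqrt_eq_rpow,
      ← Real.rpow_neg (Nat.cast_nonneg m)]
    norm_num
  calc hollow (Φᵀ * Φ) i j ^ 2 = |(Φᵀ * Φ) i j| ^ 2 := by rw [hollow_apply_of_ne _ hij, sq_abs]
    _ ≤ (C₁ * (m : ℝ) ^ (-(1 / 4) : ℝ)) ^ 2 := pow_le_pow_left₀ (abs_nonneg _) hcoherence 2
    _ = C₁ ^ 2 / √m := by rw [mul_pow, hroot, div_eq_mul_inv]

theorem sum_gram_sq_le {C₂ : ℝ} (hunit : UnitNormColumns Φ)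
    (h : meanSquareCoherence Φ ≤ C₂ * (m : ℝ)⁻¹) (hm : 0 < m) (hmN : m ≤ N) (hN : 2 ≤ N)
    (i : Fin N) : ∑ j, (Φᵀ * Φ) i j ^ 2 ≤ (1 + |C₂|) * N / m := by
  have hm' : (0 : ℝ) < m := by exact_mod_cast hm
  have hN' : (2 : ℝ) ≤ N := by exact_mod_cast hN
  have hoffdiag : ∑ j ∈ Finset.univ.erase i, (Φᵀ * Φ) i j ^ 2 ≤ (N - 1) * (|C₂| * (m : ℝ)⁻¹) := by
    have hle := (le_ciSup (f := fun j : Fin N => 1 / ((N : ℝ) - 1) *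
      ∑ i ∈ Finset.univ.erase j, pairCoherence Φ i j ^ 2) (Set.finite_range _).bddAbove i).trans
      (h.trans (mul_le_mul_of_nonneg_right (le_abs_self C₂) (by positivity)))
    rw [one_div, inv_mul_le_iff₀ (by linarith)] at hle
    refine le_of_eq_of_le (Finset.sum_congr rfl fun j _ => ?_) hle
    rw [pairCoherence, sq_abs, dotProduct_comm]
    rfl
  rw [← Finset.add_sum_erase _ _ (Finset.mem_univ i), gram_apply_self hunit]
  calc 1 ^ 2 + ∑ j ∈ Finset.univ.erase i, (Φᵀ * Φ) i j ^ 2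
      ≤ N / m + N * (|C₂| * (m : ℝ)⁻¹) := by
        refine add_le_add ?_ (hoffdiag.trans ?_)
        · rw [one_pow, one_le_div hm']
          exact_mod_cast hmN
        · gcongr
          linarith
    _ = (1 + |C₂|) * N / m := by ring

theorem exists_subsetProb_not_wellConditioned_le (C₁ K c : ℝ) (hK : 1 ≤ K) (hc : 0 < c) :
    ∃ L₀ : ℝ, 1 ≤ L₀ ∧ ∀ (m N k P : ℕ) (L : ℝ) (Φ : Matrix (Fin m) (Fin N) ℝ), L₀ ≤ L →
      P ≤ 3 * L → 1 ≤ k → m ≤ N → c * (k * L ^ 3) ≤ m → (∀ i, (Φᵀ * Φ) i i = 1) →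
      (∀ i j, hollow (Φᵀ * Φ) i j ^ 2 ≤ C₁ ^ 2 / √m) →
      (∀ i, ∑ j, (Φᵀ * Φ) i j ^ 2 ≤ K * N / m) →
      k ≤ N ∧ subsetProb k (fun I => ¬ WellConditioned Φ (1 / (5000 * L)) I) ≤
        4 * (N * Real.exp (-P)) := by
  set q := C₁ ^ 2 / √c
  set D := 45000 * (40000 * q * (q + 1) + 1)
  have hD0 : 0 ≤ D := by positivity
  have hconst : 1 ≤ K * Real.exp D := one_le_mul_of_one_le_of_one_le hK (Real.one_le_exp hD0)
  refine ⟨max 1 (100000 * (K * Real.exp D) / c), le_max_left _ _, ?_⟩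
  intro m N k P L Φ hL hPL hk hmN hcm hdiag hγ hρ
  have hL1 : 1 ≤ L := (le_max_left _ _).trans hL
  have hk1 : (1 : ℝ) ≤ k := by exact_mod_cast hk
  have hmN' : (m : ℝ) ≤ N := by exact_mod_cast hmN
  have hm0 : (0 : ℝ) < m := lt_of_lt_of_le (by positivity) hcm
  have hm : 100000 * (K * Real.exp D) * (k * L ^ 2) ≤ m := by
    have h := (le_max_right _ _).trans hL
    rw [div_le_iff₀ hc] at h
    calc _ ≤ L * c * (k * L ^ 2) := by gcongr
      _ = c * (k * L ^ 3) := by ring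
      _ ≤ m := hcm
  have hkN : 1000 * k ≤ N := by
    have hprod : (k : ℝ) ≤ K * Real.exp D * (k * L ^ 2) := by
      calc (k : ℝ) = 1 * (k * 1) := by ring
        _ ≤ K * Real.exp D * (k * L ^ 2) := by
          gcongr
          exact one_le_pow₀ hL1
    have : (1000 : ℝ) * k ≤ N := by linarith
    exact_mod_cast this
  have hsize : 100000 * Real.exp D * L ^ 2 * (K * N / m * k) ≤ N := by
    calc _ = 100000 * (K * Real.exp D) * (k * L ^ 2) * (N / m) := by ring
      _ ≤ m * (N / m) := by gcongr
      _ = N := mul_div_cancel₀ _ hm0.ne'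
  refine ⟨by omega, ?_⟩
  simpa using subsetProb_not_wellConditioned_le_exp hL1 hPL hk (by simpa using hkN) hD0 hdiag hγ
    hρ (by simpa using hsize) (mul_entry_le_or_sq_mul_entry_le (by positivity) hk1 hL1
      (div_sqrt_le_of_mul_le (sq_nonneg C₁) hc (by positivity) (by positivity) hcm))

theorem mul_exp_neg_log_add_le {ε N : ℝ} {P : ℕ} (hN : 6 ≤ N) (hε : 0 < ε) (hε1 : ε ≤ 1)
    (hP : 2 * Real.log (N / ε) ≤ P) :
    4 * (N * Real.exp (-P)) +
      N * (2 * Real.exp (-1 / (8 * (1 / (5000 * Real.log (N / ε)))))) ≤ ε := by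
  set L := Real.log (N / ε) with hL
  have hL0 : 0 < L := Real.log_pos ((one_lt_div hε).2 (by linarith))
  have hexp : N * Real.exp (-(2 * L)) = ε ^ 2 / N := by
    rw [Real.exp_neg, two_mul, Real.exp_add, hL, Real.exp_log (by positivity)]
    field_simp
  have htail : -1 / (8 * (1 / (5000 * L))) = -(625 * L) := by
    field_simp
    norm_num
  calc _ ≤ 4 * (N * Real.exp (-(2 * L))) + N * (2 * Real.exp (-(2 * L))) := by
        rw [htail]
        gcongr
        linarith
    _ = 6 * ε ^ 2 / N := by linear_combination 6 * hexp
    _ ≤ ε := by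
        rw [div_le_iff₀ (by linarith)]
        nlinarith [mul_le_mul hε1 hN (by norm_num) zero_le_one]

end Asymptotics

end SparseRecovery

theorem mainTheorem4_general (C₁ C₂ c : ℝ) (hc : 0 < c) :
    ∃ N₀ : ℕ, ∀ (m N k : ℕ) (ε : ℝ) (Φ : Matrix (Fin m) (Fin N) ℝ),
      N₀ ≤ N → m ≤ N → 1 ≤ k → 0 < ε →
      SparseRecovery.UnitNormColumns Φ →
      SparseRecovery.mutualCoherence Φ ≤ C₁ * (m : ℝ) ^ (-(1 / 4) : ℝ) →
      SparseRecovery.meanSquareCoherence Φ ≤ C₂ * (m : ℝ)⁻¹ →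
      c * (k * Real.log (N / ε) ^ 3) ≤ m →
      ∀ {Ω : Type*} [MeasurableSpace Ω] (P : Measure Ω) [IsProbabilityMeasure P]
        (x : Ω → Fin N → ℝ),
        SparseRecovery.IsGenericRandomSignal P k x →
        (∀ᵐ ω ∂P, SparseRecovery.IsSparse k (x ω)) →
        P {ω | ¬ SparseRecovery.BPRecovers Φ (x ω)} ≤ ENNReal.ofReal ε := by
  open SparseRecovery in
  obtain ⟨L₀, hL₀, hprob⟩ := exists_subsetProb_not_wellConditioned_le C₁ (1 + |C₂|) c
    (by linarith [abs_nonneg C₂]) hc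
  refine ⟨max 6 ⌈Real.exp L₀⌉₊, ?_⟩
  intro m N k ε Φ hN hmN hk hε hunit hμ hμ₂ hm Ω _ P _ x hx hsparse
  rcases le_total 1 ε with hε1 | hε1
  · exact prob_le_one.trans (ENNReal.one_le_ofReal.2 hε1)
  have hN6 : (6 : ℝ) ≤ N := by exact_mod_cast (le_max_left _ _).trans hN
  have hL : L₀ ≤ Real.log (N / ε) := by
    rw [Real.le_log_iff_exp_le (by positivity)]
    exact (Nat.ceil_le.1 ((le_max_right _ _).trans hN)).trans (le_div_self (by positivity) hε hε1)
  have hL1 : 1 ≤ Real.log (N / ε) := hL₀.trans hL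
  have hm0 : (0 : ℝ) < m := lt_of_lt_of_le (by positivity) hm
  obtain ⟨hkN, hbad⟩ := hprob m N k ⌈2 * Real.log (N / ε)⌉₊ _ Φ hL
    (by linarith [Nat.ceil_lt_add_one (a := 2 * Real.log (N / ε)) (by positivity)]) hk hmN hm
    (gram_apply_self hunit) (hollow_gram_sq_le hμ)
    (sum_gram_sq_le hunit hμ₂ (by exact_mod_cast hm0) hmN (by omega))
  exact (hx.measure_not_bpRecovers_le (a := 1 / (5000 * Real.log (N / ε))) hkN hsparse
    (by positivity)).trans (ENNReal.ofReal_le_ofReal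
      ((add_le_add_left hbad _).trans (mul_exp_neg_log_add_le hN6 hε hε1 (Nat.le_ceil _))))

theorem mainTheorem4 (C₁ C₂ C₃ c C : ℝ) (hc : 0 < c) :
    ∃ N₀ : ℕ, ∀ (m N k : ℕ) (ε : ℝ) (Φ : Matrix (Fin m) (Fin N) ℝ),
      N₀ ≤ N → m ≤ N → 1 ≤ k → 0 < ε → (k : ℝ) < 1 / ε →
      SparseRecovery.UnitNormColumns Φ →
      SparseRecovery.mutualCoherence Φ ≤ C₁ * (m : ℝ) ^ (-(1 / 4) : ℝ) →
      SparseRecovery.meanSquareCoherence Φ ≤ C₂ * (m : ℝ)⁻¹ →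
      SparseRecovery.specNorm Φ ≤ C₃ * Real.sqrt ((N : ℝ) / k) →
      c * (k * Real.log (N / ε) ^ 3) ≤ m →
      (m : ℝ) ≤ C * (k * Real.log (N / ε) ^ 3) →
      ∀ {Ω : Type*} [MeasurableSpace Ω] (P : MeasureTheory.Measure Ω)
        [MeasureTheory.IsProbabilityMeasure P] (x : Ω → Fin N → ℝ),
        SparseRecovery.IsGenericRandomSignal P k x →
        (∀ᵐ ω ∂P, SparseRecovery.IsSparse k (x ω)) →
        P {ω | ¬ SparseRecovery.BPRecovers Φ (x ω)} ≤ ENNReal.ofReal ε := by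
  obtain ⟨N₀, h⟩ := mainTheorem4_general C₁ C₂ c hc
  exact ⟨N₀, fun m N k ε Φ hN hmN hk hε _ hunit hμ hμ₂ _ hm _ =>
    h m N k ε Φ hN hmN hk hε hunit hμ hμ₂ hm⟩
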